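/- **Conventions.** Algorithms are deterministic programs for a word RAM with unit-cost arithmetic, bitwise operations and memory access, whose words have $O(\log N)$ bits on inputs of length $N$ (for some constant $k$ depending on the program, all words are smaller than $(N+2)^k$). *Orthogonal Vectors Hypothesis (OVH).* For no constant $\epsilon>0$ is there an algorithm that, given two families $X,Y$ of $n\ge 1$ binary vectors of length $d\ge 1$ each, decides in time $O(\mathrm{poly}(d)\,n^{2-\epsilon})$ whether there are $x\in X$, $y\in Y$ with $x\cdot y=0$. *Elastic founder graphs.* Let $M$ be a multiple sequence alignment, that is, a matrix with $m\ge 1$ rows and $n\ge 1$ columns and entries in $\Sigma\cup\{\text{-}\}$, where $\text{-}\notin\Sigma$ is the gap symbol; $\mathrm{spell}$ removes the gap symbols from a string. A proper segmentation of $M$ is a partition of $[1..n]$ into consecutive nonempty intervals $[x_1..y_1],\dots,[x_b..y_b]$ such that $\mathrm{spell}(M[i,x_k..y_k])$ is nonempty for all $i,k$. The elastic founder graph induced by it is the graph $G=(V,E,\ell)$ with node labels $\ell:V\to\Sigma^+$ and $V=V^1\sqcup\dots\sqcup V^b$, where, for each $k$, the labels of the nodes in $V^k$ are pairwise distinct and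 form the set $\{\mathrm{spell}(M[i,x_k..y_k]) : 1\le i\le m\}$, and where $(v,w)\in E$ if and only if there are $k\in[1..b-1]$ and $t\in[1..m]$ with $v\in V^k$, $w\in V^{k+1}$ and $\mathrm{spell}(M[t,x_k..y_{k+1}])=\ell(v)\ell(w)$. A string $Q$ has a match in $G$ if $Q$ is a substring of the concatenation of the node labels along some path of $G$ (single nodes are paths). The input of the matching problem consists of an elastic founder graph $G=(V,E,\ell)$ over an alphabet of size $\sigma$, given by its node labels and its list of edges, and of a nonempty query string $Q$; $N=O(|V|+\sum_{v\in V}|\ell(v)|+|E|+|Q|)$ denotes the total length of this input. **Theorem.** Assume OVH, and let $\epsilon>0$ be any constant. Then there is no algorithm that decides whether a query string $Q$ has a match in an elastic founder graph $G=(V,E,\ell)$ in time $O(N+|E|^{1-\epsilon}\,|Q|)$, and there is none that does so in time $O(N+|E|\,|Q|^{1-\epsilon})$. In particular none runs in time $O(|E|^{1-\epsilon}\,|Q|)$ or $O(|E|\,|Q|^{1-\epsilon})$. This holds for every fixed alphabet size $\sigma\ge 4$, in particular if the problem is restricted to an alphabet of size $4$. -/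

import Mathlib

/-! ### Word RAM

Unit-cost random access machine. A state consists of registers (a program mentions finitely many
of them) and a memory indexed by natural numbers. Programs are written in structured form (sequence,
branch, loop), which differs from jumps by a constant factor only, since a program counter
can be kept in a register. -/

namespace WordRAM

/-- Arithmetic and bitwise operations on words; each costs one step. -/
inductive BinOp
  | add | sub | mul | div | mod | land | lor | xor | shiftl | shiftr

/-- Meaning of the operations: `sub` is truncated at zero, `x / 0 = 0`, `x % 0 = x`. -/
def BinOp.eval : BinOp → ℕ → ℕ → ℕ
  | add, x, y => x + y
  | sub, x, y => x - y
  | mul, x, y => x * y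
  | div, x, y => x / y
  | mod, x, y => x % y
  | land, x, y => x &&& y
  | lor, x, y => x ||| y
  | xor, x, y => x ^^^ y
  | shiftl, x, y => x <<< y
  | shiftr, x, y => x >>> y

/-- Programs. Registers and literals are fixed numbers in the program text. -/
inductive Prog
  /-- `r := c` -/
  | lit (r c : ℕ)
  /-- `r := a ∘ b` -/
  | op (o : BinOp) (r a b : ℕ)
  /-- `r := mem[a]` -/
  | load (r a : ℕ)
  /-- `mem[a] := r` -/
  | store (a r : ℕ)
  | seq (p q : Prog)
  /-- if register `a` is nonzero then `p` else `q` -/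
  | branch (a : ℕ) (p q : Prog)
  /-- while register `a` is nonzero do `p` -/
  | loop (a : ℕ) (p : Prog)

/-- Machine states. -/
structure State where
  reg : ℕ → ℕ
  mem : ℕ → ℕ

def State.setReg (s : State) (r v : ℕ) : State := { s with reg := Function.update s.reg r v }

def State.setMem (s : State) (i v : ℕ) : State := { s with mem := Function.update s.mem i v }

/-- `Exec B p s t s'`: started in state `s`, the program `p` halts in state `s'` after exactly `t`
steps, and every word that it writes (in particular every address that it computes) is smaller
than `B`. Every assignment, every memory access and every test costs one step. -/
inductive Exec (B : ℕ) : Prog → State → ℕ → State → Prop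
  | lit {r c : ℕ} {s : State} (h : c < B) :
      Exec B (.lit r c) s 1 (s.setReg r c)
  | op {o : BinOp} {r a b : ℕ} {s : State} (h : o.eval (s.reg a) (s.reg b) < B) :
      Exec B (.op o r a b) s 1 (s.setReg r (o.eval (s.reg a) (s.reg b)))
  | load {r a : ℕ} {s : State} (h : s.mem (s.reg a) < B) :
      Exec B (.load r a) s 1 (s.setReg r (s.mem (s.reg a)))
  | store {a r : ℕ} {s : State} (h : s.reg r < B) :
      Exec B (.store a r) s 1 (s.setMem (s.reg a) (s.reg r))
  | seq {p q : Prog} {s₁ s₂ s₃ : State} {t₁ t₂ : ℕ} :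
      Exec B p s₁ t₁ s₂ → Exec B q s₂ t₂ s₃ → Exec B (.seq p q) s₁ (t₁ + t₂) s₃
  | branch_true {a : ℕ} {p q : Prog} {s s' : State} {t : ℕ} (h : s.reg a ≠ 0) :
      Exec B p s t s' → Exec B (.branch a p q) s (t + 1) s'
  | branch_false {a : ℕ} {p q : Prog} {s s' : State} {t : ℕ} (h : s.reg a = 0) :
      Exec B q s t s' → Exec B (.branch a p q) s (t + 1) s'
  | loop_done {a : ℕ} {p : Prog} {s : State} (h : s.reg a = 0) :
      Exec B (.loop a p) s 1 s
  | loop_step {a : ℕ} {p : Prog} {s₁ s₂ s₃ : State} {t₁ t₂ : ℕ} (h : s₁.reg a ≠ 0) :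
      Exec B p s₁ t₁ s₂ → Exec B (.loop a p) s₂ t₂ s₃ →
        Exec B (.loop a p) s₁ (t₁ + t₂ + 1) s₃

/-- Initial state: the input is written in the memory cells `0, 1, …`, all the rest is zero. -/
def initState (input : List ℕ) : State where
  reg := fun _ => 0
  mem := fun i => input.getD i 0

/-- The program `P` decides the promise problem with instances `{x | valid x}`, input encoding
`enc` and yes-instances `yes`, in at most `T x` steps on every valid instance `x`, with words of
`O(log N)` bits, where `N` is the input length: for some constant `k`, all words stay below
`(N + 2) ^ k`. The answer is `yes` when register `0` is nonzero at the end. -/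
def Decides {I : Type} (P : Prog) (valid : I → Prop) (enc : I → List ℕ) (yes : I → Prop)
    (T : I → ℝ) : Prop :=
  ∃ k : ℕ, ∀ x, valid x → ∃ (t : ℕ) (s : State),
    Exec (((enc x).length + 2) ^ k) P (initState (enc x)) t s ∧
      (t : ℝ) ≤ T x ∧ (s.reg 0 ≠ 0 ↔ yes x)

end WordRAM

/-! ### Orthogonal vectors -/

/-- Two families of `n` binary vectors of length `d`. -/
structure OVInstance where
  n : ℕ
  d : ℕ
  X : Fin n → Fin d → Bool
  Y : Fin n → Fin d → Bool

namespace OVInstance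

def Valid (I : OVInstance) : Prop := 1 ≤ I.n ∧ 1 ≤ I.d

/-- Some `x ∈ X` and `y ∈ Y` have dot product zero. -/
def HasOrthogonalPair (I : OVInstance) : Prop :=
  ∃ i j, ∑ h, (I.X i h).toNat * (I.Y j h).toNat = 0

/-- The entries of the vectors, one vector after the other. -/
def vectorWords {n d : ℕ} (Z : Fin n → Fin d → Bool) : List ℕ :=
  (List.ofFn fun i => List.ofFn fun h => (Z i h).toNat).flatten

def encode (I : OVInstance) : List ℕ :=
  [I.n, I.d] ++ vectorWords I.X ++ vectorWords I.Y

end OVInstance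

/-- Orthogonal Vectors Hypothesis: for no constant `ε > 0` can orthogonal vectors be solved in time
`O(poly(d) n ^ (2 - ε))`. -/
def OrthogonalVectorsHypothesis : Prop :=
  ∀ ε : ℝ, 0 < ε → ¬ ∃ (P : WordRAM.Prog) (c : ℕ) (C : ℝ),
    WordRAM.Decides P OVInstance.Valid OVInstance.encode OVInstance.HasOrthogonalPair
      (fun I => C * ((I.d : ℝ) ^ c * (I.n : ℝ) ^ (2 - ε)))

/-! ### Multiple sequence alignments and elastic founder graphs -/

/-- A multiple sequence alignment with `m` rows and `n` columns over an alphabet of size `σ`;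
`none` is the gap symbol. -/
abbrev MSA (σ m n : ℕ) : Type := Matrix (Fin m) (Fin n) (Option (Fin σ))

namespace MSA

/-- The string left when the gaps are removed from row `t` restricted to the columns
`x, x + 1, …, y - 1` (columns are numbered from `0`). -/
def spell {σ m n : ℕ} (M : MSA σ m n) (t : Fin m) (x y : ℕ) : List (Fin σ) :=
  (((List.ofFn (M t)).drop x).take (y - x)).reduceOption

end MSA

/-- A finite directed graph with nodes labelled by strings over an alphabet of size `σ`. The edge
set is given as a list without repetitions, in any order. -/
structure LabeledGraph (σ : ℕ) where
  nodes : ℕ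
  edges : List (Fin nodes × Fin nodes)
  edges_nodup : edges.Nodup
  label : Fin nodes → List (Fin σ)

namespace LabeledGraph

variable {σ : ℕ}

/-- `G` is induced by the segmentation of `M` into `b` segments, the `k`-th of which consists of the
columns `cut k, …, cut (k + 1) - 1`; node `v` lies in block `blk v`. -/
structure InducedBy (G : LabeledGraph σ) {m n : ℕ} (M : MSA σ m n) (b : ℕ) (cut : ℕ → ℕ)
    (blk : Fin G.nodes → ℕ) : Prop where
  cut_zero : cut 0 = 0
  cut_last : cut b = n
  cut_lt : ∀ k < b, cut k < cut (k + 1)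
  /-- the segmentation is proper -/
  proper : ∀ k < b, ∀ t, M.spell t (cut k) (cut (k + 1)) ≠ []
  blk_lt : ∀ v, blk v < b
  /-- the node labels of a block are the strings of the segment -/
  labels : ∀ k < b,
    {w | ∃ t, w = M.spell t (cut k) (cut (k + 1))} = {w | ∃ v, blk v = k ∧ w = G.label v}
  /-- different nodes of a block have different labels -/
  label_inj : ∀ v w, blk v = blk w → G.label v = G.label w → v = w
  /-- edges join consecutive blocks and are those supported by a row -/
  edge_iff : ∀ v w, (v, w) ∈ G.edges ↔
    blk w = blk v + 1 ∧
      ∃ t, M.spell t (cut (blk v)) (cut (blk v + 2)) = G.label v ++ G.label w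

/-- `G` is an elastic founder graph: it is induced by a proper segmentation of some multiple
sequence alignment with at least one row and one column. -/
def IsElasticFounderGraph (G : LabeledGraph σ) : Prop :=
  ∃ (m n : ℕ) (M : MSA σ m n) (b : ℕ) (cut : ℕ → ℕ) (blk : Fin G.nodes → ℕ),
    1 ≤ m ∧ 1 ≤ n ∧ G.InducedBy M b cut blk

/-- A path: a nonempty sequence of nodes, consecutive ones joined by an edge. -/
def IsPath (G : LabeledGraph σ) (p : List (Fin G.nodes)) : Prop :=
  p ≠ [] ∧ p.IsChain fun u v => (u, v) ∈ G.edges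

/-- The string `Q` has a match in `G`: it is a substring of the label of a path. -/
def Matches (G : LabeledGraph σ) (Q : List (Fin σ)) : Prop :=
  ∃ p, G.IsPath p ∧ Q <:+: p.flatMap G.label

end LabeledGraph

/-- A graph and a query string. -/
structure MatchInstance (σ : ℕ) where
  G : LabeledGraph σ
  Q : List (Fin σ)

namespace MatchInstance

variable {σ : ℕ}

def Valid (I : MatchInstance σ) : Prop := I.G.IsElasticFounderGraph ∧ I.Q ≠ []

def HasMatch (I : MatchInstance σ) : Prop := I.G.Matches I.Q

/-- A string as a list of words. -/
def stringWords (w : List (Fin σ)) : List ℕ := w.map Fin.val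

/-- The numbers of nodes, edges and query symbols, then for each node the length of its label and
the label, then the two ends of each edge, then the query. -/
def encode (I : MatchInstance σ) : List ℕ :=
  [I.G.nodes, I.G.edges.length, I.Q.length] ++
    (List.ofFn fun v => (I.G.label v).length :: stringWords (I.G.label v)).flatten ++
    (I.G.edges.flatMap fun e => [e.1.val, e.2.val]) ++
    stringWords I.Q

/-- Total size of the input. -/
def size (I : MatchInstance σ) : ℕ := I.encode.length

def numEdges (I : MatchInstance σ) : ℕ := I.G.edges.length

def queryLength (I : MatchInstance σ) : ℕ := I.Q.length

/-- Some program decides on all elastic founder graphs over an alphabet of size `σ` and all query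
strings whether the query has a match, in time `O(T)`. -/
def SolvableInTime (σ : ℕ) (T : MatchInstance σ → ℝ) : Prop :=
  ∃ (P : WordRAM.Prog) (C : ℝ),
    WordRAM.Decides P Valid encode HasMatch (fun I : MatchInstance σ => C * T I)

end MatchInstance

/-! ### Executions of word RAM programs -/

namespace WordRAM

/-! The proof reduces orthogonal vectors in linear time to matching in a graph in which consecutive
blocks are completely joined, so all the information sits in the node labels. A column of the graph
consists of a delimiter block and `d` coordinate blocks and stands for one vector of `Y`; there are
three copies of `Y` in a row. The query is `0`, then for every `x` of `X` the piece `3 2 2` followed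
by `b 2 2` for each bit `b`, and finally `3 0`.

A match may cut this string into node labels in three ways, according to how many of the two spacers
after a delimiter belong to the delimiter node. In phase two the coordinate nodes read `b 2 2`, in
phase zero `2 2 b`; both are available for every bit, whatever the vector of the column is. In phase
one they read `2 b 2`, and `2 1 2` exists only where the vector of the column has a zero. A whole
vector `x` is thus read in phase one exactly if it is orthogonal to that of the column.

No label contains `0 3`, so the first delimiter of the query starts a node and the phase is two or
one. It stays so as long as phase two lasts, but the closing `3 0` has no room for spacers. Hence
some column is read in phase one and yields an orthogonal pair (`exists_orthogonal_of_query_infix`).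
Conversely, for an orthogonal pair one stays in phase two before the column of the pair, reads that
column in phase one and continues in phase zero (`exists_path_query`). The three copies of `Y` give
enough columns on both sides.

The graph is an elastic founder graph because 36 rows suffice to realise all pairs of nodes in
consecutive blocks (`isElasticFounderGraph_graph`). Size, edge number and query length are all `O(n
d)`, so a fast matching algorithm would solve orthogonal vectors in time `O(d ^ 2 * n ^ (2 - δ))`
(`rpow_mul_le`, `not_solvableInTime_of_le`). The reduction itself is an explicit program
(`exists_exec_reductionProg`), built from a small language of list-emitting commands whose
compilation is verified once and for all (`EmitCmd.exists_exec`). -/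

theorem Exec.mono {B B' : ℕ} (hB : B ≤ B') {p : Prog} {s s' : State} {t : ℕ}
    (h : Exec B p s t s') : Exec B' p s t s' := by
  induction h with
  | lit h => exact .lit (h.trans_le hB)
  | op h => exact .op (h.trans_le hB)
  | load h => exact .load (h.trans_le hB)
  | store h => exact .store (h.trans_le hB)
  | seq _ _ h₁ h₂ => exact .seq h₁ h₂
  | branch_true h _ ih => exact .branch_true h ih
  | branch_false h _ ih => exact .branch_false h ih
  | loop_done h => exact .loop_done h
  | loop_step h _ _ h₁ h₂ => exact .loop_step h h₁ h₂

/-- All registers assigned by the program are below this number. -/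
def Prog.regBound : Prog → ℕ
  | .lit r _ => r + 1
  | .op _ r _ _ => r + 1
  | .load r _ => r + 1
  | .store _ _ => 0
  | .seq p q => max p.regBound q.regBound
  | .branch _ p q => max p.regBound q.regBound
  | .loop _ p => p.regBound

/-- This is what allows the reduction to restore the initial register contents: only finitely many
registers need to be cleared. -/
theorem Exec.reg_eq {B : ℕ} {p : Prog} {s s' : State} {t : ℕ} (h : Exec B p s t s') {r : ℕ}
    (hr : p.regBound ≤ r) : s'.reg r = s.reg r := by
  induction h with
  | lit h | op h | load h =>
    simp only [Prog.regBound] at hr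
    simp only [State.setReg]
    exact Function.update_of_ne (by omega) _ _
  | store h => rfl
  | seq _ _ h₁ h₂ =>
    simp only [Prog.regBound, max_le_iff] at hr
    rw [h₂ hr.2, h₁ hr.1]
  | branch_true h _ ih => exact ih (le_of_max_le_left hr)
  | branch_false h _ ih => exact ih (le_of_max_le_right hr)
  | loop_done h => rfl
  | loop_step h _ _ h₁ h₂ => rw [h₂ hr, h₁ hr]

/-- The loop rule for a number of rounds known in advance; the invariant is indexed by the round,
and every round also pays one step for the test. -/
theorem exists_exec_loop {B a : ℕ} {p : Prog} {n : ℕ} (Inv : ℕ → State → Prop) (cost : ℕ → ℕ)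
    (hstep : ∀ i < n, ∀ s, Inv i s → s.reg a ≠ 0 ∧
      ∃ t s', Exec B p s t s' ∧ t ≤ cost i ∧ Inv (i + 1) s')
    (hend : ∀ s, Inv n s → s.reg a = 0) {s : State} (h0 : Inv 0 s) :
    ∃ t s', Exec B (.loop a p) s t s' ∧ t ≤ 1 + ∑ i ∈ Finset.range n, (cost i + 1) ∧
      Inv n s' := by
  suffices H : ∀ k i s, i + k = n → Inv i s → ∃ t s', Exec B (.loop a p) s t s' ∧
      t ≤ 1 + ∑ j ∈ Finset.range k, (cost (i + j) + 1) ∧ Inv n s' by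
    obtain ⟨t, s', h₁, h₂, h₃⟩ := H n 0 s (by omega) h0
    exact ⟨t, s', h₁, by simpa using h₂, h₃⟩
  intro k
  induction k with
  | zero =>
    intro i s hi hs
    obtain rfl : i = n := by omega
    exact ⟨1, s, .loop_done (hend s hs), by simp, hs⟩
  | succ k ih =>
    intro i s hi hs
    obtain ⟨hne, t₁, s₁, he₁, ht₁, hs₁⟩ := hstep i (by omega) s hs
    obtain ⟨t₂, s₂, he₂, ht₂, hs₂⟩ := ih (i + 1) s₁ (by omega) hs₁
    refine ⟨_, s₂, .loop_step hne he₁ he₂, ?_, hs₂⟩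
    rw [Finset.sum_range_succ']
    have : ∀ j, i + 1 + j = i + (j + 1) := fun j => by omega
    simp only [this] at ht₂
    simp only [add_zero]
    omega

/-! ### Expressions -/

/-- Expressions over registers and memory cells. -/
inductive WordExpr
  | lit (c : ℕ)
  | var (i : ℕ)
  | op (o : BinOp) (a b : WordExpr)
  | load (a : WordExpr)

/-- The operation enlarges words only polynomially. -/
def BinOp.Tame (o : BinOp) : Prop := ∀ x y, o.eval x y ≤ (x + 1) * (y + 1)

theorem BinOp.tame_add : BinOp.Tame .add := fun x y => by simp only [BinOp.eval]; nlinarith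

theorem BinOp.tame_sub : BinOp.Tame .sub := fun x y =>
  (Nat.sub_le x y).trans (by nlinarith)

theorem BinOp.tame_mul : BinOp.Tame .mul := fun x y => by simp only [BinOp.eval]; nlinarith

theorem BinOp.tame_div : BinOp.Tame .div := fun x y =>
  (Nat.div_le_self x y).trans (by nlinarith)

theorem BinOp.tame_mod : BinOp.Tame .mod := fun x y =>
  (Nat.mod_le x y).trans (by nlinarith)

namespace WordExpr

def eval (rd ρ : ℕ → ℕ) : WordExpr → ℕ
  | lit c => c
  | var i => ρ i
  | op o a b => o.eval (a.eval rd ρ) (b.eval rd ρ)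
  | load a => rd (a.eval rd ρ)

/-- Evaluate into register `r`, with scratch registers above `r`. -/
def compile : WordExpr → ℕ → Prog
  | lit c, r => .lit r c
  -- A bitwise or of a register with itself serves as a move instruction.
  | var i, r => .op .lor r i i
  | op o a b, r => .seq (a.compile r) (.seq (b.compile (r + 1)) (.op o r r (r + 1)))
  | load a, r => .seq (a.compile r) (.load r r)

def steps : WordExpr → ℕ
  | lit _ => 1
  | var _ => 1
  | op _ a b => a.steps + (b.steps + 1)
  | load a => a.steps + 1

/-- If variables and memory words are at most `M ^ D`, then all intermediate values are at most
`M ^ e.deg D`. -/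
def deg (D : ℕ) : WordExpr → ℕ
  -- For `2 ≤ M` one has `c < M ^ c`.
  | lit c => c
  | var _ => D
  | op _ a b => a.deg D + b.deg D + 2
  | load a => a.deg D + D

/-- The variables are registers `1, …, r - 1`, and only addresses in `A` are read. -/
def Ok (A : ℕ → Prop) (rd ρ : ℕ → ℕ) (r : ℕ) : WordExpr → Prop
  | lit _ => True
  | var i => 1 ≤ i ∧ i < r
  | op o a b => o.Tame ∧ a.Ok A rd ρ r ∧ b.Ok A rd ρ r
  | load a => a.Ok A rd ρ r ∧ A (a.eval rd ρ)

variable {A : ℕ → Prop} {rd ρ : ℕ → ℕ} {r M D : ℕ}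

theorem eval_le {e : WordExpr} (hM : 2 ≤ M) (hρ : ∀ i, 1 ≤ i → i < r → ρ i ≤ M ^ D)
    (hrd : ∀ a, A a → rd a ≤ M ^ D) (he : e.Ok A rd ρ r) : e.eval rd ρ ≤ M ^ e.deg D := by
  induction e with
  | lit c => exact (Nat.lt_pow_self (by omega : 1 < M)).le
  | var i => exact hρ i he.1 he.2
  | op o a b iha ihb =>
    have key : ∀ k, M ^ k + 1 ≤ M ^ (k + 1) := fun k => by
      have := Nat.one_le_pow k M (by omega)
      rw [pow_succ]; nlinarith
    calc o.eval (a.eval rd ρ) (b.eval rd ρ)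
        ≤ (a.eval rd ρ + 1) * (b.eval rd ρ + 1) := he.1 _ _
      _ ≤ (M ^ a.deg D + 1) * (M ^ b.deg D + 1) := by
          gcongr
          · exact iha he.2.1
          · exact ihb he.2.2
      _ ≤ M ^ (a.deg D + 1) * M ^ (b.deg D + 1) := Nat.mul_le_mul (key _) (key _)
      _ = M ^ (op o a b).deg D := by rw [← pow_add]; congr 1; simp only [deg]; omega
  | load a ih =>
    exact (hrd _ he.2).trans (Nat.pow_le_pow_right (by omega) (by simp [deg]))

/-- Operands are evaluated into increasing registers, so the induction needs the target `r'` to be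
arbitrary above the variables and all registers below `r'` to survive, including the output pointer
in register `0`. -/
theorem exists_exec {e : WordExpr} {B : ℕ} {s : State} (hM : 2 ≤ M)
    (hB : M ^ e.deg D < B) (hρ : ∀ i, 1 ≤ i → i < r → ρ i ≤ M ^ D)
    (hrd : ∀ a, A a → rd a ≤ M ^ D) (he : e.Ok A rd ρ r)
    {r' : ℕ} (hr : r ≤ r') (hreg : ∀ i, 1 ≤ i → i < r → s.reg i = ρ i)
    (hmem : ∀ a, A a → s.mem a = rd a) :
    ∃ s', Exec B (e.compile r') s e.steps s' ∧ s'.mem = s.mem ∧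
      (∀ i < r', s'.reg i = s.reg i) ∧ s'.reg r' = e.eval rd ρ := by
  induction e generalizing s r' with
  | lit c =>
    refine ⟨_, .lit ((Nat.lt_pow_self (by omega : 1 < M)).trans hB), rfl, fun i hi => ?_, ?_⟩
    · exact Function.update_of_ne (by omega) _ _
    · simp [State.setReg, eval]
  | var i =>
    have h1 : BinOp.lor.eval (s.reg i) (s.reg i) = ρ i := by
      simp [BinOp.eval, hreg i he.1 he.2]
    refine ⟨_, .op (by rw [h1]; exact (hρ i he.1 he.2).trans_lt hB), rfl, fun i hi => ?_, ?_⟩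
    · exact Function.update_of_ne (by omega) _ _
    · simp only [State.setReg, Function.update_self, h1, eval]
  | op o a b iha ihb =>
    have hle : M ^ (op o a b).deg D < B := hB
    have ha : M ^ a.deg D < B := (Nat.pow_le_pow_right (by omega) (by simp [deg]; omega)).trans_lt hB
    have hb : M ^ b.deg D < B := (Nat.pow_le_pow_right (by omega) (by simp [deg]; omega)).trans_lt hB
    obtain ⟨s₁, e₁, m₁, p₁, v₁⟩ := iha ha he.2.1 hr hreg hmem
    obtain ⟨s₂, e₂, m₂, p₂, v₂⟩ := ihb (s := s₁) (r' := r' + 1) hb he.2.2 (by omega)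
      (fun i h1 h2 => by rw [p₁ i (by omega), hreg i h1 h2]) (fun a ha => by rw [m₁, hmem a ha])
    have hv : o.eval (s₂.reg r') (s₂.reg (r' + 1)) = (op o a b).eval rd ρ := by
      rw [v₂, p₂ r' (by omega), v₁]; rfl
    refine ⟨_, .seq e₁ (.seq e₂ (.op ?_)), ?_, fun i hi => ?_, ?_⟩
    · rw [hv]; exact (eval_le hM hρ hrd he).trans_lt hB
    · simp [State.setReg, m₁, m₂]
    · simp only [State.setReg]
      rw [Function.update_of_ne (by omega), p₂ i (by omega), p₁ i hi]
    · simp only [State.setReg, Function.update_self, hv]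
  | load a ih =>
    have ha : M ^ a.deg D < B := (Nat.pow_le_pow_right (by omega) (by simp [deg])).trans_lt hB
    obtain ⟨s₁, e₁, m₁, p₁, v₁⟩ := ih ha he.1 hr hreg hmem
    have hv : s₁.mem (s₁.reg r') = (load a).eval rd ρ := by
      rw [m₁, v₁, hmem _ he.2]; rfl
    refine ⟨_, .seq e₁ (.load ?_), ?_, fun i hi => ?_, ?_⟩
    · rw [hv]; exact (eval_le hM hρ hrd he).trans_lt hB
    · simp [State.setReg, m₁]
    · simp only [State.setReg]
      rw [Function.update_of_ne (by omega), p₁ i hi]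
    · simp only [State.setReg, Function.update_self, hv]

end WordExpr

/-! ### Emitting lists -/

/-- The memory after the list `w` has been written from address `o` on. -/
def overwrite (m : ℕ → ℕ) (o : ℕ) (w : List ℕ) : ℕ → ℕ :=
  fun i => if o ≤ i ∧ i < o + w.length then w.getD (i - o) 0 else m i

@[simp] theorem overwrite_nil (m : ℕ → ℕ) (o : ℕ) : overwrite m o [] = m := by
  ext i; simp only [overwrite, List.length_nil]; rw [if_neg (by omega)]

theorem overwrite_singleton (m : ℕ → ℕ) (o v : ℕ) :
    overwrite m o [v] = Function.update m o v := by
  ext i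
  by_cases h : i = o
  · subst h; simp [overwrite]
  · rw [Function.update_of_ne h]
    simp only [overwrite, List.length_singleton]; rw [if_neg (by omega)]

theorem overwrite_append (m : ℕ → ℕ) (o : ℕ) (w₁ w₂ : List ℕ) :
    overwrite (overwrite m o w₁) (o + w₁.length) w₂ = overwrite m o (w₁ ++ w₂) := by
  ext i
  simp only [overwrite, List.length_append]
  by_cases h1 : o + w₁.length ≤ i
  · by_cases h2 : i < o + w₁.length + w₂.length
    · rw [if_pos ⟨h1, h2⟩, if_pos ⟨by omega, by omega⟩, List.getD_append_right _ _ _ _ (by omega)]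
      congr 1; omega
    · rw [if_neg (by omega), if_neg (by omega), if_neg (by omega)]
  · rw [if_neg (by omega)]
    by_cases h2 : o ≤ i
    · rw [if_pos (by omega), if_pos (by omega), List.getD_append _ _ _ _ (by omega)]
    · rw [if_neg (by omega), if_neg (by omega)]

theorem overwrite_of_lt {m : ℕ → ℕ} {o i : ℕ} (w : List ℕ) (h : i < o) :
    overwrite m o w i = m i := by
  simp only [overwrite]; rw [if_neg (by omega)]

theorem overwrite_of_ge {m : ℕ → ℕ} {o i : ℕ} {w : List ℕ} (h : o + w.length ≤ i) :
    overwrite m o w i = m i := by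
  simp only [overwrite]; rw [if_neg (by omega)]

/-- Programs that write a list into consecutive memory cells. -/
inductive EmitCmd
  | emit (e : WordExpr)
  | seq (c₁ c₂ : EmitCmd)
  | forN (e : WordExpr) (c : EmitCmd)

namespace EmitCmd

/-- The values of the variables in the `i`-th of `n` rounds of a loop. -/
def loopEnv (ρ : ℕ → ℕ) (r n i : ℕ) : ℕ → ℕ :=
  Function.update (Function.update (Function.update ρ r i) (r + 1) (n - i)) (r + 2) n

/-- The emitted list. -/
def out (rd : ℕ → ℕ) : EmitCmd → ℕ → (ℕ → ℕ) → List ℕ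
  | emit e, _, ρ => [e.eval rd ρ]
  | seq c₁ c₂, r, ρ => c₁.out rd r ρ ++ c₂.out rd r ρ
  | forN e c, r, ρ =>
    (List.range (e.eval rd ρ)).flatMap fun i => c.out rd (r + 3) (loopEnv ρ r (e.eval rd ρ) i)

/-- Register `0` points to the next free cell, registers `1, …, r - 1` hold variables. -/
def compile : EmitCmd → ℕ → Prog
  | emit e, r => .seq (e.compile r) (.seq (.store 0 r) (.seq (.lit r 1) (.op .add 0 0 r)))
  | seq c₁ c₂, r => .seq (c₁.compile r) (c₂.compile r)
  -- Register `r + 1` holds the number of remaining rounds and is the loop condition. At the end of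
  -- a round it briefly holds the increment `1` and is then recomputed from the bound in `r + 2`.
  | forN e c, r => .seq (e.compile (r + 2)) (.seq (.lit r 0) (.seq (.op .lor (r + 1) (r + 2) (r + 2))
      (.loop (r + 1) (.seq (c.compile (r + 3)) (.seq (.lit (r + 1) 1)
        (.seq (.op .add r r (r + 1)) (.op .sub (r + 1) (r + 2) r)))))))

/-- Running time up to a constant factor. -/
def steps (rd : ℕ → ℕ) : EmitCmd → ℕ → (ℕ → ℕ) → ℕ
  | emit _, _, _ => 1
  | seq c₁ c₂, r, ρ => c₁.steps rd r ρ + c₂.steps rd r ρ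
  | forN e c, r, ρ => 1 + ∑ i ∈ Finset.range (e.eval rd ρ),
      (c.steps rd (r + 3) (loopEnv ρ r (e.eval rd ρ) i) + 1)

def Ok (A : ℕ → Prop) (rd : ℕ → ℕ) : EmitCmd → ℕ → (ℕ → ℕ) → Prop
  | emit e, r, ρ => e.Ok A rd ρ r
  | seq c₁ c₂, r, ρ => c₁.Ok A rd r ρ ∧ c₂.Ok A rd r ρ
  | forN e c, r, ρ => e.Ok A rd ρ r ∧ ∀ i < e.eval rd ρ,
      c.Ok A rd (r + 3) (loopEnv ρ r (e.eval rd ρ) i)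

theorem loopEnv_of_lt (ρ : ℕ → ℕ) {r n i j : ℕ} (h : j < r) : loopEnv ρ r n i j = ρ j := by
  simp only [loopEnv]
  rw [Function.update_of_ne (by omega), Function.update_of_ne (by omega),
    Function.update_of_ne (by omega)]

@[simp] theorem loopEnv_self (ρ : ℕ → ℕ) (r n i : ℕ) : loopEnv ρ r n i r = i := by
  simp only [loopEnv]
  rw [Function.update_of_ne (by omega), Function.update_of_ne (by omega), Function.update_self]

theorem loopEnv_one (ρ : ℕ → ℕ) (r n i : ℕ) : loopEnv ρ r n i (r + 1) = n - i := by
  simp only [loopEnv]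
  rw [Function.update_of_ne (by omega), Function.update_self]

theorem loopEnv_two (ρ : ℕ → ℕ) (r n i : ℕ) : loopEnv ρ r n i (r + 2) = n := by
  simp only [loopEnv, Function.update_self]

/-- The constants `K` and `C` depend on the command only and are chosen before the instance, which
gives words of `O(log N)` bits and a uniform time bound. The set `A` of readable addresses must
avoid the cells about to be written, so the values read remain those of `rd` during the whole
execution. -/
theorem exists_exec (c : EmitCmd) : ∀ r D : ℕ, 1 ≤ r → ∃ K C : ℕ, ∀ (M B : ℕ) (s : State)
    (A : ℕ → Prop) (rd ρ : ℕ → ℕ), 2 ≤ M → M ^ K < B → c.Ok A rd r ρ →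
    (∀ i, 1 ≤ i → i < r → ρ i ≤ M ^ D) → (∀ a, A a → rd a ≤ M ^ D) →
    (∀ i, 1 ≤ i → i < r → s.reg i = ρ i) → (∀ a, A a → s.mem a = rd a) →
    s.reg 0 + (c.out rd r ρ).length ≤ M ^ D →
    (∀ a, A a → a < s.reg 0 ∨ s.reg 0 + (c.out rd r ρ).length ≤ a) →
    ∃ t s', Exec B (c.compile r) s t s' ∧ t ≤ C * c.steps rd r ρ ∧
      s'.reg 0 = s.reg 0 + (c.out rd r ρ).length ∧
      s'.mem = overwrite s.mem (s.reg 0) (c.out rd r ρ) ∧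
      ∀ i, 1 ≤ i → i < r → s'.reg i = s.reg i := by
  induction c with
  | emit e =>
    intro r D hr
    refine ⟨e.deg D + D + 1, e.steps + 3, ?_⟩
    intro M B s A rd ρ hM hB hok hρ hrd hreg hmem hlen _
    have hle : ∀ k ≤ e.deg D + D + 1, M ^ k < B := fun k hk =>
      (Nat.pow_le_pow_right (by omega) hk).trans_lt hB
    obtain ⟨s₁, e₁, m₁, p₁, v₁⟩ :=
      e.exists_exec (B := B) hM (hle _ (by omega)) hρ hrd hok le_rfl hreg hmem
    have h1 : 1 < B := lt_of_lt_of_le (by simpa using hle 0 (by omega)) le_rfl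
    simp only [out, List.length_singleton] at hlen ⊢
    refine ⟨_, _, .seq e₁ (.seq (.store ?_) (.seq (.lit h1) (.op ?_))), ?_, ?_, ?_, ?_⟩
    · rw [v₁]; exact (WordExpr.eval_le hM hρ hrd hok).trans_lt (hle _ (by omega))
    · simp only [State.setReg, State.setMem, BinOp.eval, Function.update_self]
      rw [Function.update_of_ne (by omega), p₁ 0 (by omega)]
      exact hlen.trans_lt (hle _ (by omega))
    · simp only [steps]; omega
    · simp only [State.setReg, State.setMem, BinOp.eval, Function.update_self]
      rw [Function.update_of_ne (by omega), p₁ 0 (by omega)]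
    · simp only [State.setReg, State.setMem, m₁, v₁, p₁ 0 (by omega)]
      rw [overwrite_singleton]
    · intro i h1 h2
      simp only [State.setReg, State.setMem]
      rw [Function.update_of_ne (by omega), Function.update_of_ne (by omega), p₁ i h2]
  | seq c₁ c₂ ih₁ ih₂ =>
    intro r D hr
    obtain ⟨K₁, C₁, H₁⟩ := ih₁ r D hr
    obtain ⟨K₂, C₂, H₂⟩ := ih₂ r D hr
    refine ⟨K₁ + K₂, C₁ + C₂, ?_⟩
    intro M B s A rd ρ hM hB hok hρ hrd hreg hmem hlen hA
    simp only [out, List.length_append] at hlen hA ⊢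
    obtain ⟨t₁, s₁, e₁, ht₁, o₁, m₁, p₁⟩ := H₁ M B s A rd ρ hM
      ((Nat.pow_le_pow_right (by omega) (by omega)).trans_lt hB) hok.1 hρ hrd hreg hmem
      (by omega) (fun a ha => by have := hA a ha; omega)
    obtain ⟨t₂, s₂, e₂, ht₂, o₂, m₂, p₂⟩ := H₂ M B s₁ A rd ρ hM
      ((Nat.pow_le_pow_right (by omega) (by omega)).trans_lt hB) hok.2 hρ hrd
      (fun i h1 h2 => by rw [p₁ i h1 h2, hreg i h1 h2])
      (fun a ha => by
        rw [m₁]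
        rcases hA a ha with h | h
        · rw [overwrite_of_lt _ h, hmem a ha]
        · rw [overwrite_of_ge (by omega), hmem a ha])
      (by omega) (fun a ha => by have := hA a ha; omega)
    refine ⟨_, s₂, .seq e₁ e₂, ?_, by omega, ?_, ?_⟩
    · simp only [steps]; nlinarith
    · rw [m₂, m₁, o₁, overwrite_append]
    · intro i h1 h2; rw [p₂ i h1 h2, p₁ i h1 h2]
  | forN e c ih =>
    intro r D hr
    -- The loop occupies three registers, whose values are bounded by `M ^ e.deg D`; inside the body
    -- they count as variables, hence the larger exponent.
    obtain ⟨K, C, H⟩ := ih (r + 3) (D + e.deg D) (by omega)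
    refine ⟨K + e.deg D + 1, e.steps + C + 7, ?_⟩
    intro M B s A rd ρ hM hB hok hρ hrd hreg hmem hlen hA
    have hle : ∀ k ≤ K + e.deg D + 1, M ^ k < B := fun k hk =>
      (Nat.pow_le_pow_right (by omega) hk).trans_lt hB
    obtain ⟨s₁, e₁, m₁, p₁, v₁⟩ := e.exists_exec (B := B) (r' := r + 2) hM (hle _ (by omega))
      hρ hrd hok.1 (by omega) hreg hmem
    have hn : e.eval rd ρ ≤ M ^ e.deg D := WordExpr.eval_le hM hρ hrd hok.1
    have hMD : ∀ x, x ≤ M ^ D → x ≤ M ^ (D + e.deg D) := fun x hx =>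
      hx.trans (Nat.pow_le_pow_right (by omega) (by omega))
    have hMe : ∀ x, x ≤ e.eval rd ρ → x ≤ M ^ (D + e.deg D) := fun x hx =>
      (hx.trans hn).trans (Nat.pow_le_pow_right (by omega) (by omega))
    have hnB : e.eval rd ρ < B := hn.trans_lt (hle _ (by omega))
    simp only [out] at hlen hA ⊢
    simp only [steps]
    have hokb := hok.2
    generalize hnn : e.eval rd ρ = n at *
    set f : ℕ → List ℕ := fun i => c.out rd (r + 3) (loopEnv ρ r n i) with hf
    have hpre : ∀ i < n, (((List.range i).flatMap f).length + (f i).length)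
        ≤ ((List.range n).flatMap f).length := by
      intro i hi
      obtain ⟨k, rfl⟩ : ∃ k, n = (i + 1) + k := ⟨n - (i + 1), by omega⟩
      rw [List.range_add, List.range_succ]
      simp only [List.flatMap_append, List.length_append, List.flatMap_cons, List.flatMap_nil,
        List.append_nil]
      omega
    have hB1 : 1 < B := by simpa using hle 0 (by omega)
    let Inv : ℕ → State → Prop := fun i s' => s'.reg r = i ∧ s'.reg (r + 1) = n - i ∧
      s'.reg (r + 2) = n ∧ (∀ j, 1 ≤ j → j < r → s'.reg j = s.reg j) ∧
      s'.reg 0 = s.reg 0 + ((List.range i).flatMap f).length ∧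
      s'.mem = overwrite s.mem (s.reg 0) ((List.range i).flatMap f)
    obtain ⟨t, s₂, e₂, ht₂, i₂⟩ := exists_exec_loop (B := B) (a := r + 1) (n := n)
      (p := .seq (c.compile (r + 3)) (.seq (.lit (r + 1) 1)
        (.seq (.op .add r r (r + 1)) (.op .sub (r + 1) (r + 2) r)))) Inv
      (fun i => C * c.steps rd (r + 3) (loopEnv ρ r n i) + 3)
      (by
        rintro i hi s' ⟨a1, a2, a3, a4, a5, a6⟩
        refine ⟨by omega, ?_⟩
        have hp := hpre i hi
        obtain ⟨t₃, s₃, e₃, ht₃, o₃, m₃, p₃⟩ := H M B s' A rd (loopEnv ρ r n i) hM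
          (hle _ (by omega)) (hokb i hi)
          (by
            intro j h1 h2
            rcases lt_trichotomy j (r + 1) with h | h | h
            · rcases Nat.lt_or_ge j r with h' | h'
              · rw [loopEnv_of_lt _ h']; exact hMD _ (hρ j h1 h')
              · obtain rfl : j = r := by omega
                rw [loopEnv_self]; exact hMe _ hi.le
            · rw [h, loopEnv_one]; exact hMe _ (by omega)
            · obtain rfl : j = r + 2 := by omega
              rw [loopEnv_two]; exact hMe _ le_rfl)
          (fun a ha => hMD _ (hrd a ha))
          (by
            intro j h1 h2
            rcases lt_trichotomy j (r + 1) with h | h | h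
            · rcases Nat.lt_or_ge j r with h' | h'
              · rw [loopEnv_of_lt _ h', a4 j h1 h', hreg j h1 h']
              · obtain rfl : j = r := by omega
                rw [loopEnv_self, a1]
            · rw [h, loopEnv_one, a2]
            · obtain rfl : j = r + 2 := by omega
              rw [loopEnv_two, a3])
          (fun a ha => by
            rw [a6]
            rcases hA a ha with h | h
            · rw [overwrite_of_lt _ h, hmem a ha]
            · rw [overwrite_of_ge (by omega), hmem a ha])
          (by
            rw [a5]
            refine hMD _ (le_trans ?_ hlen)
            change _ + (f i).length ≤ _
            omega)
          (fun a ha => by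
            rw [a5]
            change _ ∨ _ + (f i).length ≤ _
            have := hA a ha; omega)
        have q1 : s₃.reg r = i := by rw [p₃ r (by omega) (by omega), a1]
        have q3 : s₃.reg (r + 2) = n := by rw [p₃ (r + 2) (by omega) (by omega), a3]
        have hrr : r ≠ r + 1 := by omega
        have hrr2 : r + 2 ≠ r := by omega
        refine ⟨_, _, .seq e₃ (.seq (.lit hB1) (.seq (.op ?_) (.op ?_))), ?_, ?_, ?_, ?_, ?_, ?_, ?_⟩
        · simp only [State.setReg, BinOp.eval, Function.update_self, Function.update_of_ne hrr, q1]
          omega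
        · simp [State.setReg, BinOp.eval, q1, q3]; omega
        · omega
        · simp [State.setReg, BinOp.eval, q1]
        · simp [State.setReg, BinOp.eval, q1, q3]
        · simp [State.setReg, q3]
        · intro j h1 h2
          simp only [State.setReg]
          rw [Function.update_of_ne (by omega), Function.update_of_ne (by omega),
            Function.update_of_ne (by omega), p₃ j h1 (by omega), a4 j h1 h2]
        · simp only [State.setReg]
          rw [Function.update_of_ne (by omega), Function.update_of_ne (by omega),
            Function.update_of_ne (by omega), o₃, a5, List.range_succ]
          simp only [List.flatMap_append, List.length_append, List.flatMap_cons, List.flatMap_nil,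
            List.append_nil, hf]
          omega
        · simp only [State.setReg]
          rw [m₃, a6, a5, overwrite_append, List.range_succ]
          simp only [List.flatMap_append, List.flatMap_cons, List.flatMap_nil, List.append_nil, hf])
      (by
        rintro s' ⟨-, a2, -⟩
        omega)
      (s := (s₁.setReg r 0).setReg (r + 1) n)
      (by
        refine ⟨?_, ?_, ?_, ?_, ?_, ?_⟩
        · simp [State.setReg]
        · simp [State.setReg]
        · simp [State.setReg, v₁]
        · intro j h1 h2
          simp only [State.setReg]
          rw [Function.update_of_ne (by omega), Function.update_of_ne (by omega),
            p₁ j (by omega)]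
        · simp only [State.setReg]
          rw [Function.update_of_ne (by omega), Function.update_of_ne (by omega),
            p₁ 0 (by omega)]
          simp
        · simp [State.setReg, m₁])
    obtain ⟨-, -, -, b4, b5, b6⟩ := i₂
    have hx : BinOp.lor.eval ((s₁.setReg r 0).reg (r + 2)) ((s₁.setReg r 0).reg (r + 2)) = n := by
      simp [State.setReg, BinOp.eval, v₁]
    have e₃ := Exec.op (B := B) (o := .lor) (r := r + 1) (a := r + 2) (b := r + 2)
      (s := s₁.setReg r 0) (by rw [hx]; exact hnB)
    rw [hx] at e₃
    refine ⟨_, s₂, .seq e₁ (.seq (.lit (by omega)) (.seq e₃ e₂)), ?_, b5, b6, b4⟩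
    have hsum : ∑ i ∈ Finset.range n, (C * c.steps rd (r + 3) (loopEnv ρ r n i) + 3 + 1) ≤
        (C + 4) * ∑ i ∈ Finset.range n, (c.steps rd (r + 3) (loopEnv ρ r n i) + 1) := by
      rw [Finset.mul_sum]
      refine Finset.sum_le_sum fun i _ => ?_
      nlinarith
    generalize ∑ i ∈ Finset.range n, (c.steps rd (r + 3) (loopEnv ρ r n i) + 1) = X at *
    have h0 := Nat.zero_le (e.steps * X)
    have h1 : (e.steps + C + 7) * (1 + X) = e.steps + C + 7 + e.steps * X + (C + 4) * X + 3 * X := by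
      ring
    omega

end EmitCmd

end WordRAM

namespace OVReduction

/-! ### The language of the graph

The symbols are `0`, `1` (bits), `2` (spacer) and `3` (delimiter). Blocks are numbered
consecutively; each column consists of a delimiter block and one block for every coordinate. The
number of spacers after the delimiter is the phase of a match: `2` before the tested pair, `1` in
the column of the tested pair. -/

/-- The labels of the nodes of a delimiter block. -/
def delimLabel : ℕ → List ℕ
  | 0 => [3, 2, 2]
  | 1 => [3, 2]
  | 2 => [2, 3]
  | 3 => [2, 2, 3]
  -- The last two labels are not needed for the paths built below; they give all blocks the same
  -- size.
  | 4 => [2, 3, 2]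
  | _ => [2, 2, 3, 2]

/-- The labels of the nodes of a coordinate block with bit `y`. -/
def coordLabel (y : ℕ) : ℕ → List ℕ
  | 0 => [0, 2, 2]
  | 1 => [1, 2, 2]
  | 2 => [2, 0, 2]
  -- For `y = 1` the label consists of spacers, so the bit `1` cannot be read in phase one.
  | 3 => [2, 1 + y, 2]
  | 4 => [2, 2, 0]
  | _ => [2, 2, 1]

/-- The label of the `r`-th node of block `b`, where `y c` is the vector of column `c`. -/
def blockLabel (d : ℕ) (y : ℕ → ℕ → ℕ) (b r : ℕ) : List ℕ :=
  if b % (d + 1) = 0 then delimLabel r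
  else coordLabel (y (b / (d + 1)) (b % (d + 1) - 1)) r

/-- Every block has six nodes. -/
def nodeLabel (d : ℕ) (y : ℕ → ℕ → ℕ) (v : ℕ) : List ℕ := blockLabel d y (v / 6) (v % 6)

/-- The rest of the query after a delimiter, when the vectors `xs` remain. -/
def queryTail : List (List ℕ) → List ℕ
  | [] => [0]
  | x :: xs => 2 :: 2 :: (x.flatMap (fun b => [b, 2, 2]) ++ 3 :: queryTail xs)

def query (xs : List (List ℕ)) : List ℕ := 0 :: 3 :: queryTail xs

/-- The nodes lie in the blocks `k, k + 1, …`. -/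
def Consecutive : ℕ → List ℕ → Prop
  | _, [] => True
  | k, v :: p => v / 6 = k ∧ Consecutive (k + 1) p

variable {d : ℕ} {y : ℕ → ℕ → ℕ}

theorem blockLabel_delim (c r : ℕ) : blockLabel d y (c * (d + 1)) r = delimLabel r := by
  simp [blockLabel]

theorem blockLabel_coord {h : ℕ} (hh : h < d) (c r : ℕ) :
    blockLabel d y (c * (d + 1) + h + 1) r = coordLabel (y c h) r := by
  have h1 : (c * (d + 1) + h + 1) % (d + 1) = h + 1 := by
    rw [add_assoc, add_comm, Nat.add_mul_mod_self_right, Nat.mod_eq_of_lt (by omega)]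
  have h2 : (c * (d + 1) + h + 1) / (d + 1) = c := by
    rw [add_assoc, add_comm, Nat.add_mul_div_right _ _ (by omega), Nat.div_eq_of_lt (by omega)]
    omega
  simp [blockLabel, h1, h2]

/-! ### From matches to orthogonal pairs -/

theorem delimLabel_or_coordLabel (hy : ∀ c h, y c h ≤ 1) (v : ℕ) :
    (v / 6 % (d + 1) = 0 ∧ nodeLabel d y v = delimLabel (v % 6)) ∨
      ∃ b ≤ 1, nodeLabel d y v = coordLabel b (v % 6) := by
  by_cases h : v / 6 % (d + 1) = 0
  · left; simp [nodeLabel, blockLabel, h]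
  · right; exact ⟨_, hy (v / 6 / (d + 1)) (v / 6 % (d + 1) - 1), by
      simp only [nodeLabel, blockLabel, if_neg h]⟩

theorem not_zero_delim_infix (hy : ∀ c h, y c h ≤ 1) (v : ℕ) :
    ¬ [0, 3] <:+: nodeLabel d y v := by
  have hv : v % 6 < 6 := Nat.mod_lt _ (by norm_num)
  rcases delimLabel_or_coordLabel (d := d) hy v with ⟨-, h⟩ | ⟨b, hb, h⟩
  · rw [h]; revert hv; generalize v % 6 = r; intro hv
    interval_cases r <;> decide
  · rw [h]; revert hv; generalize v % 6 = r; intro hv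
    interval_cases b <;> interval_cases r <;> decide

/-- Phase one: a node that reads `2 b 2` with a bit `b` must be `2 0 2`, so that `b = 0`, or `2 (1 +
y) 2`, so that `y = 0`. Either way it is used up exactly, and the argument continues in the next
block. -/
theorem mul_eq_zero_of_shifted_prefix (hy : ∀ c h, y c h ≤ 1) (c : ℕ) (x : List ℕ)
    (hx : ∀ b ∈ x, b ≤ 1) (h : ℕ) (p : List ℕ) (hd : h + x.length ≤ d)
    (hp : Consecutive (c * (d + 1) + h + 1) p)
    (hpre : x.flatMap (fun b => [2, b, 2]) <+: p.flatMap (nodeLabel d y))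
    (i : ℕ) (hi : i < x.length) : x[i] * y c (h + i) = 0 := by
  induction x generalizing h p i with
  | nil => simp at hi
  | cons b x ih =>
    simp only [List.length_cons] at hd hi
    match p, hp with
    | [], _ => simp at hpre
    | w :: p, hp =>
      have hb := hx b (by simp)
      have hw : nodeLabel d y w = coordLabel (y c h) (w % 6) := by
        rw [nodeLabel, hp.1, blockLabel_coord (by omega)]
      have hr : w % 6 < 6 := Nat.mod_lt _ (by norm_num)
      simp only [List.flatMap_cons, hw] at hpre
      have hyc := hy c h
      have key : b * y c h = 0 ∧
          x.flatMap (fun b => [2, b, 2]) <+: p.flatMap (nodeLabel d y) := by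
        revert hpre hr
        generalize w % 6 = r
        intro hr hpre
        interval_cases r <;>
          simp only [coordLabel, List.cons_append, List.nil_append, List.cons_prefix_cons] at hpre
        · omega
        · omega
        · exact ⟨by rw [hpre.2.1, zero_mul], hpre.2.2.2⟩
        · refine ⟨?_, hpre.2.2.2⟩
          have := hpre.2.1
          rw [show y c h = 0 by omega, mul_zero]
        · omega
        · omega
      cases i with
      | zero => simpa using key.1
      | succ i =>
        have := ih (fun b hb => hx b (by simp [hb])) (h + 1) p (by omega)
          (by have := hp.2; rwa [show c * (d + 1) + (h + 1) + 1 = c * (d + 1) + h + 1 + 1 by ring])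
          key.2 i (by omega)
        simpa [add_assoc, add_comm, add_left_comm] using this

/-- Phase two: a label that starts with a bit is exactly `b 2 2`, so every coordinate uses up one
node and the next delimiter of the query again starts a node. This is how alignment passes from one
column to the next. -/
theorem exists_delim_of_aligned_prefix (c : ℕ) (x : List ℕ) (hx : ∀ b ∈ x, b ≤ 1) (t : List ℕ)
    (h : ℕ) (p : List ℕ) (hd : h + x.length = d) (hp : Consecutive (c * (d + 1) + h + 1) p)
    (hpre : x.flatMap (fun b => [b, 2, 2]) ++ 3 :: t <+: p.flatMap (nodeLabel d y)) :
    ∃ w q, Consecutive ((c + 1) * (d + 1)) (w :: q) ∧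
      3 :: t <+: nodeLabel d y w ++ q.flatMap (nodeLabel d y) := by
  induction x generalizing h p with
  | nil =>
    match p, hp with
    | [], _ => simp at hpre
    | w :: p, hp =>
      refine ⟨w, p, ?_, by simpa using hpre⟩
      rwa [show (c + 1) * (d + 1) = c * (d + 1) + h + 1 by simp at hd; subst hd; ring]
  | cons b x ih =>
    simp only [List.length_cons] at hd
    match p, hp with
    | [], _ => simp at hpre
    | w :: p, hp =>
      have hb := hx b (by simp)
      have hw : nodeLabel d y w = coordLabel (y c h) (w % 6) := by
        rw [nodeLabel, hp.1, blockLabel_coord (by omega)]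
      have hr : w % 6 < 6 := Nat.mod_lt _ (by norm_num)
      simp only [List.flatMap_cons, hw] at hpre
      refine ih (fun b hb => hx b (by simp [hb])) (h + 1) p (by omega)
        (by have := hp.2; rwa [show c * (d + 1) + (h + 1) + 1 = c * (d + 1) + h + 1 + 1 by ring]) ?_
      revert hpre hr
      generalize w % 6 = r
      intro hr hpre
      interval_cases r <;>
        simp only [coordLabel, List.cons_append, List.nil_append, List.cons_prefix_cons] at hpre
      · exact hpre.2.2.2
      · exact hpre.2.2.2
      all_goals omega

/-- Only the labels `3 2 2` and `3 2` start with a delimiter; the two alternatives are phases two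
and one. -/
theorem delim_cases {w : ℕ} {t u : List ℕ} (hy : ∀ c h, y c h ≤ 1)
    (hpre : 3 :: t <+: nodeLabel d y w ++ u) :
    w / 6 % (d + 1) = 0 ∧ (t <+: 2 :: 2 :: u ∨ t <+: 2 :: u) := by
  have hr : w % 6 < 6 := Nat.mod_lt _ (by norm_num)
  rcases delimLabel_or_coordLabel (d := d) hy w with ⟨h0, h⟩ | ⟨b, hb, h⟩
  · rw [h] at hpre
    refine ⟨h0, ?_⟩
    revert hpre hr; generalize w % 6 = r; intro hpre hr
    interval_cases r <;>
      simp only [delimLabel, List.cons_append, List.nil_append, List.cons_prefix_cons] at hpre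
    · exact .inl hpre.2
    · exact .inr hpre.2
    all_goals omega
  · rw [h] at hpre
    exfalso
    revert hpre hr; generalize w % 6 = r; intro hr hpre
    interval_cases r <;>
      simp only [coordLabel, List.cons_append, List.nil_append, List.cons_prefix_cons] at hpre <;>
      omega

/-- `x` and `z` have dot product zero, as bit sequences of length `d`. -/
def Orthogonal (d : ℕ) (x : List ℕ) (z : ℕ → ℕ) : Prop := ∀ i < d, x.getD i 0 * z i = 0

theorem flatMap_aligned_eq (x : List ℕ) :
    2 :: x.flatMap (fun b => [b, 2, 2]) = x.flatMap (fun b => [2, b, 2]) ++ [2] := by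
  induction x with
  | nil => rfl
  | cons b x ih => simp only [List.flatMap_cons, List.cons_append, List.nil_append, ih]

theorem flatMap_aligned_eq' (x : List ℕ) :
    2 :: 2 :: x.flatMap (fun b => [b, 2, 2]) = x.flatMap (fun b => [2, 2, b]) ++ [2, 2] := by
  induction x with
  | nil => rfl
  | cons b x ih => simp only [List.flatMap_cons, List.cons_append, List.nil_append, ih]

/-- In phase two the column is skipped and the next delimiter again leads to phase two or one. In
phase one the current vector is orthogonal to that of the column and the search ends. When no vector
remains, the final `0` would have to match a spacer, so phase one must have occurred before. -/
theorem exists_orthogonal_of_queryTail (hy : ∀ c h, y c h ≤ 1) (xs : List (List ℕ))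
    (hlen : ∀ x ∈ xs, x.length = d) (hbit : ∀ x ∈ xs, ∀ b ∈ x, b ≤ 1) (c : ℕ) (p : List ℕ)
    (hp : Consecutive (c * (d + 1) + 1) p)
    (hpre : queryTail xs <+: 2 :: 2 :: p.flatMap (nodeLabel d y) ∨
      queryTail xs <+: 2 :: p.flatMap (nodeLabel d y)) :
    ∃ x ∈ xs, ∃ c, Orthogonal d x (y c) := by
  induction xs generalizing c p with
  | nil => simp [queryTail, List.cons_prefix_cons] at hpre
  | cons x xs ih =>
    have hxl := hlen x (by simp)
    have hxb := hbit x (by simp)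
    simp only [queryTail, List.cons_prefix_cons, true_and] at hpre
    rcases hpre with hpre | hpre
    · obtain ⟨w, q, hq, hpre'⟩ := exists_delim_of_aligned_prefix c x hxb _ 0 p (by omega) hp hpre
      obtain ⟨-, hc⟩ := delim_cases hy hpre'
      obtain ⟨x', hx', H⟩ := ih (fun x hx => hlen x (by simp [hx]))
        (fun x hx => hbit x (by simp [hx])) (c + 1) q hq.2 hc
      exact ⟨x', by simp [hx'], H⟩
    · refine ⟨x, by simp, c, fun i hi => ?_⟩
      have hsh : x.flatMap (fun b => [2, b, 2]) <+: p.flatMap (nodeLabel d y) := by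
        refine List.IsPrefix.trans ?_ hpre
        rw [← List.cons_append, flatMap_aligned_eq, List.append_assoc]
        exact List.prefix_append _ _
      have := mul_eq_zero_of_shifted_prefix hy c x hxb 0 p (by omega) hp hsh i (by omega)
      rw [List.getD_eq_getElem _ _ (by omega)]
      simpa using this

/-- A match of the query reveals an orthogonal pair. -/
theorem exists_orthogonal_of_query_infix (hy : ∀ c h, y c h ≤ 1) (xs : List (List ℕ))
    (hlen : ∀ x ∈ xs, x.length = d) (hbit : ∀ x ∈ xs, ∀ b ∈ x, b ≤ 1) (k : ℕ) (p : List ℕ)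
    (hp : Consecutive k p) (h : query xs <:+: p.flatMap (nodeLabel d y)) :
    ∃ x ∈ xs, ∃ c, Orthogonal d x (y c) := by
  induction p generalizing k with
  | nil => simp [query] at h
  | cons v p ih =>
    have hv := not_zero_delim_infix (d := d) hy v
    rw [List.flatMap_cons, List.infix_append_iff] at h
    rcases h with h | h | ⟨l₁, l₂, h, h₁, h₂⟩
    · exact absurd (List.IsInfix.trans ⟨[], queryTail xs, by simp [query]⟩ h) hv
    · exact ih (k + 1) hp.2 h
    -- The query straddles the end of the first label. As this label does not contain `0 3`, the
    -- only cut inside the first two query symbols that remains is the one between them.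
    · match l₁, h with
      | [], h => exact ih (k + 1) hp.2 (h ▸ h₂.isInfix)
      | [a], h =>
        simp only [query, List.cons_append, List.nil_append, List.cons.injEq] at h
        obtain ⟨-, rfl⟩ := h
        match p, hp with
        | [], _ => simp at h₂
        | w :: q, hp =>
          obtain ⟨h0, hc⟩ := delim_cases hy (by simpa using h₂)
          obtain ⟨c, hcc⟩ := Nat.dvd_of_mod_eq_zero h0
          have hq := hp.2.2
          rw [← hp.2.1, hcc, mul_comm] at hq
          exact exists_orthogonal_of_queryTail hy xs hlen hbit c q hq hc
      | a :: b :: l, h =>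
        simp only [query, List.cons_append, List.cons.injEq] at h
        obtain ⟨rfl, rfl, -⟩ := h
        exact absurd (List.IsInfix.trans ⟨[], l, by simp⟩ h₁.isInfix) hv

/-! ### From orthogonal pairs to matches -/

theorem Consecutive.append {k : ℕ} {p q : List ℕ} (hp : Consecutive k p)
    (hq : Consecutive (k + p.length) q) : Consecutive k (p ++ q) := by
  induction p generalizing k with
  | nil => simpa using hq
  | cons v p ih =>
    refine ⟨hp.1, ih hp.2 ?_⟩
    rwa [List.length_cons, show k + (p.length + 1) = k + 1 + p.length by ring] at hq

theorem Consecutive.lt {k : ℕ} {p : List ℕ} (hp : Consecutive k p) {v : ℕ} (hv : v ∈ p) :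
    v < 6 * (k + p.length) := by
  induction p generalizing k with
  | nil => simp at hv
  | cons w p ih =>
    rw [List.length_cons]
    rcases List.mem_cons.1 hv with rfl | hv
    · have := hp.1; omega
    · have := ih hp.2 hv; omega

theorem Consecutive.isChain {k : ℕ} {p : List ℕ} (hp : Consecutive k p) :
    p.IsChain fun v w => w / 6 = v / 6 + 1 := by
  induction p generalizing k with
  | nil => exact .nil
  | cons v p ih =>
    match p, hp with
    | [], _ => exact .singleton _
    | w :: q, hp =>
      refine .cons_cons ?_ (ih hp.2)
      rw [hp.1, hp.2.1]

theorem consecutive_of_isChain {v : ℕ} {p : List ℕ}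
    (h : (v :: p).IsChain fun v w => w / 6 = v / 6 + 1) : Consecutive (v / 6) (v :: p) := by
  induction p generalizing v with
  | nil => exact ⟨rfl, trivial⟩
  | cons w p ih =>
    rw [List.isChain_cons_cons] at h
    exact ⟨rfl, h.1 ▸ ih h.2⟩

/-- The nodes of the coordinate blocks of a column that are chosen by `f`. -/
theorem exists_coord_path (c : ℕ) (f : ℕ → ℕ) (hf : ∀ b, f b < 6) (g : ℕ → List ℕ) (x : List ℕ) (h : ℕ)
    (hd : h + x.length = d) (hg : ∀ i (hi : i < x.length), coordLabel (y c (h + i)) (f x[i]) = g x[i]) :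
    ∃ p, p.length = x.length ∧ Consecutive (c * (d + 1) + h + 1) p ∧
      p.flatMap (nodeLabel d y) = x.flatMap g := by
  induction x generalizing h with
  | nil => exact ⟨[], rfl, trivial, rfl⟩
  | cons b x ih =>
    simp only [List.length_cons] at hd hg
    obtain ⟨p, hl, hp, ht⟩ := ih (h + 1) (by omega) (fun i hi => by
      have := hg (i + 1) (by omega)
      simp only [List.getElem_cons_succ] at this
      rwa [show h + 1 + i = h + (i + 1) by ring])
    have hfb := hf b
    have h6 : (6 * (c * (d + 1) + h + 1) + f b) / 6 = c * (d + 1) + h + 1 := by omega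
    have h6' : (6 * (c * (d + 1) + h + 1) + f b) % 6 = f b := by omega
    refine ⟨(6 * (c * (d + 1) + h + 1) + f b) :: p, by simp [hl], ⟨h6, ?_⟩, ?_⟩
    · rwa [show c * (d + 1) + h + 1 + 1 = c * (d + 1) + (h + 1) + 1 by ring]
    · rw [List.flatMap_cons, List.flatMap_cons, ht, nodeLabel, h6, h6', blockLabel_coord (by omega)]
      congr 1
      simpa using hg 0 (by omega)

theorem nodeLabel_delim (c r : ℕ) (hr : r < 6) :
    (6 * (c * (d + 1)) + r) / 6 = c * (d + 1) ∧
      nodeLabel d y (6 * (c * (d + 1)) + r) = delimLabel r := by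
  have h6 : (6 * (c * (d + 1)) + r) / 6 = c * (d + 1) := by omega
  refine ⟨h6, ?_⟩
  rw [nodeLabel, h6, blockLabel_delim]
  congr 1; omega

/-- Phase zero: the spacers of the query are regrouped as `2 2 b`, and `2 2 3` closes a column, so
any vectors can be read in any columns. -/
theorem exists_path_after (hd : 0 < d) (xs : List (List ℕ)) (hlen : ∀ x ∈ xs, x.length = d)
    (hbit : ∀ x ∈ xs, ∀ b ∈ x, b ≤ 1) (c : ℕ) :
    ∃ p, p.length = xs.length * (d + 1) + 1 ∧ Consecutive (c * (d + 1) + 1) p ∧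
      queryTail xs <+: p.flatMap (nodeLabel d y) := by
  induction xs generalizing c with
  | nil =>
    -- The node `0 2 2` of the first coordinate block supplies the final `0`; it accounts for the
    -- extra block in the length.
    refine ⟨[6 * (c * (d + 1) + 0 + 1)], by simp, ⟨by omega, trivial⟩, ?_⟩
    have h6 : 6 * (c * (d + 1) + 0 + 1) / 6 = c * (d + 1) + 0 + 1 := by omega
    have h6' : 6 * (c * (d + 1) + 0 + 1) % 6 = 0 := by omega
    rw [List.flatMap_cons, nodeLabel, h6, h6', blockLabel_coord hd]
    simp [queryTail, coordLabel]
  | cons x xs ih =>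
    have hxl := hlen x (by simp)
    have hxb := hbit x (by simp)
    obtain ⟨q, hql, hq, hqt⟩ := ih (fun x hx => hlen x (by simp [hx]))
      (fun x hx => hbit x (by simp [hx])) (c + 1)
    obtain ⟨p, hpl, hp, hpt⟩ := exists_coord_path (d := d) (y := y) c (fun b => 4 + min b 1)
      (fun b => by omega) (fun b => [2, 2, b]) x 0 (by omega) (fun i hi => by
        have := hxb x[i] (by simp)
        generalize x[i] = b at *
        interval_cases b <;> rfl)
    obtain ⟨hw, hwl⟩ := nodeLabel_delim (d := d) (y := y) (c + 1) 3 (by norm_num)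
    refine ⟨p ++ (6 * ((c + 1) * (d + 1)) + 3) :: q, ?_, hp.append ⟨?_, ?_⟩, ?_⟩
    · simp only [List.length_append, List.length_cons, hpl, hql, hxl]; ring
    · rw [hw, hpl, hxl]; ring
    · rwa [hpl, hxl, show c * (d + 1) + 0 + 1 + d + 1 = (c + 1) * (d + 1) + 1 by ring]
    · rw [List.flatMap_append, List.flatMap_cons, hpt, hwl, queryTail, ← List.cons_append,
        ← List.cons_append, flatMap_aligned_eq', List.append_assoc]
      simpa [delimLabel, List.prefix_append_right_inj, List.cons_prefix_cons] using hqt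

/-- Phase one: orthogonality provides a node `2 b 2` in every coordinate block. The spacer left over
goes into the delimiter node `2 3`, after which the match is in phase zero. -/
theorem exists_path_test (hd : 0 < d) (x : List ℕ) (xs : List (List ℕ))
    (hlen : ∀ z ∈ x :: xs, z.length = d) (hbit : ∀ z ∈ x :: xs, ∀ b ∈ z, b ≤ 1) (c : ℕ)
    (horth : Orthogonal d x (y c)) :
    ∃ p, p.length = (xs.length + 1) * (d + 1) + 1 ∧ Consecutive (c * (d + 1) + 1) p ∧
      queryTail (x :: xs) <+: 2 :: p.flatMap (nodeLabel d y) := by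
  have hxl := hlen x (by simp)
  have hxb := hbit x (by simp)
  obtain ⟨q, hql, hq, hqt⟩ := exists_path_after (y := y) hd xs (fun x hx => hlen x (by simp [hx]))
      (fun x hx => hbit x (by simp [hx])) (c + 1)
  obtain ⟨p, hpl, hp, hpt⟩ := exists_coord_path (d := d) (y := y) c (fun b => 2 + min b 1)
    (fun b => by omega) (fun b => [2, b, 2]) x 0 (by omega) (fun i hi => by
      have h1 := hxb x[i] (by simp)
      have h2 := horth i (by omega)
      rw [List.getD_eq_getElem _ _ hi] at h2
      rw [zero_add]
      generalize x[i] = b at *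
      interval_cases b
      · rfl
      · rw [one_mul] at h2
        rw [h2]; rfl)
  obtain ⟨hw, hwl⟩ := nodeLabel_delim (d := d) (y := y) (c + 1) 2 (by norm_num)
  refine ⟨p ++ (6 * ((c + 1) * (d + 1)) + 2) :: q, ?_, hp.append ⟨?_, ?_⟩, ?_⟩
  · simp only [List.length_append, List.length_cons, hpl, hql, hxl]; ring
  · rw [hw, hpl, hxl]; ring
  · rwa [hpl, hxl, show c * (d + 1) + 0 + 1 + d + 1 = (c + 1) * (d + 1) + 1 by ring]
  · rw [List.flatMap_append, List.flatMap_cons, hpt, hwl, queryTail, List.cons_prefix_cons,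
      ← List.cons_append, flatMap_aligned_eq, List.append_assoc]
    simpa [delimLabel, List.prefix_append_right_inj, List.cons_prefix_cons] using hqt

/-- Phase two lasts for the vectors in `pre`; the delimiter node `3 2` then switches to phase one in
front of `x`. -/
theorem exists_path_before (hd : 0 < d) (pre : List (List ℕ)) (x : List ℕ) (xs : List (List ℕ))
    (hlen : ∀ z ∈ pre ++ x :: xs, z.length = d) (hbit : ∀ z ∈ pre ++ x :: xs, ∀ b ∈ z, b ≤ 1)
    (c : ℕ) (horth : Orthogonal d x (y (c + pre.length))) :
    ∃ p, p.length = (pre.length + xs.length + 1) * (d + 1) + 2 ∧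
      Consecutive (c * (d + 1)) p ∧
      3 :: queryTail (pre ++ x :: xs) <+: p.flatMap (nodeLabel d y) := by
  induction pre generalizing c with
  | nil =>
    obtain ⟨p, hpl, hp, hpt⟩ := exists_path_test hd x xs hlen hbit c horth
    obtain ⟨hw, hwl⟩ := nodeLabel_delim (d := d) (y := y) c 1 (by norm_num)
    refine ⟨(6 * (c * (d + 1)) + 1) :: p, ?_, ⟨hw, hp⟩, ?_⟩
    · simp only [List.length_cons, hpl, List.length_nil]; ring
    · rw [List.flatMap_cons, hwl]
      simpa [delimLabel, List.cons_prefix_cons] using hpt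
  | cons z pre ih =>
    have hzl := hlen z (by simp)
    have hzb := hbit z (by simp)
    obtain ⟨q, hql, hq, hqt⟩ := ih (fun x hx => hlen x (by simp at hx ⊢; tauto))
      (fun x hx => hbit x (by simp at hx ⊢; tauto)) (c + 1)
      (by simpa [add_assoc, add_comm, add_left_comm] using horth)
    obtain ⟨p, hpl, hp, hpt⟩ := exists_coord_path (d := d) (y := y) c (fun b => min b 1)
      (fun b => by omega) (fun b => [b, 2, 2]) z 0 (by omega) (fun i hi => by
        have := hzb z[i] (by simp)
        generalize z[i] = b at *
        interval_cases b <;> rfl)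
    obtain ⟨hw, hwl⟩ := nodeLabel_delim (d := d) (y := y) c 0 (by norm_num)
    refine ⟨(6 * (c * (d + 1)) + 0) :: (p ++ q), ?_, ⟨hw, hp.append ?_⟩, ?_⟩
    · simp only [List.length_append, List.length_cons, hpl, hql, hzl]; ring
    · rwa [hpl, hzl, show c * (d + 1) + 0 + 1 + d = (c + 1) * (d + 1) by ring]
    · rw [List.flatMap_cons, List.flatMap_append, hpt, hwl, List.cons_append, queryTail]
      simpa [delimLabel, List.prefix_append_right_inj, List.cons_prefix_cons] using hqt

/-- An orthogonal pair yields a match of the query. -/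
theorem exists_path_query (hd : 0 < d) (pre : List (List ℕ)) (x : List ℕ) (xs : List (List ℕ))
    (hlen : ∀ z ∈ pre ++ x :: xs, z.length = d) (hbit : ∀ z ∈ pre ++ x :: xs, ∀ b ∈ z, b ≤ 1)
    (c : ℕ) (horth : Orthogonal d x (y (c + 1 + pre.length))) :
    ∃ p, p.length = (pre.length + xs.length + 1) * (d + 1) + 3 ∧
      Consecutive (c * (d + 1) + d) p ∧
      query (pre ++ x :: xs) <:+: p.flatMap (nodeLabel d y) := by
  obtain ⟨p, hpl, hp, hpt⟩ := exists_path_before hd pre x xs hlen hbit (c + 1) horth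
  obtain ⟨e, rfl⟩ : ∃ e, d = e + 1 := ⟨d - 1, by omega⟩
  have h6 : (6 * (c * (e + 1 + 1) + e + 1) + 4) / 6 = c * (e + 1 + 1) + e + 1 := by omega
  have h6' : (6 * (c * (e + 1 + 1) + e + 1) + 4) % 6 = 4 := by omega
  -- The node `2 2 0` in the last coordinate block of column `c` supplies the leading `0`.
  refine ⟨(6 * (c * (e + 1 + 1) + e + 1) + 4) :: p, by simp [hpl], ⟨h6, ?_⟩, ?_⟩
  · rwa [show c * (e + 1 + 1) + (e + 1) + 1 = (c + 1) * (e + 1 + 1) by ring]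
  · rw [List.flatMap_cons, nodeLabel, h6, h6', blockLabel_coord (by omega)]
    obtain ⟨t, ht⟩ := hpt
    exact ⟨[2, 2], t, by rw [← ht]; simp [query, coordLabel]⟩

end OVReduction

namespace OVReduction

/-! ### The instance of the matching problem -/

/-- The entries of a family of vectors, zero outside the range. -/
def bit {n d : ℕ} (Z : Fin n → Fin d → Bool) (i h : ℕ) : ℕ :=
  if hh : i < n ∧ h < d then (Z ⟨i, hh.1⟩ ⟨h, hh.2⟩).toNat else 0

theorem bit_le_one {n d : ℕ} (Z : Fin n → Fin d → Bool) (i h : ℕ) : bit Z i h ≤ 1 := by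
  unfold bit
  split
  · exact Bool.toNat_le _
  · omega

def vectors {n d : ℕ} (Z : Fin n → Fin d → Bool) : List (List ℕ) :=
  (List.range n).map fun i => (List.range d).map fun h => bit Z i h

/-- The family `Y` is repeated periodically. -/
def colBit (I : OVInstance) (c h : ℕ) : ℕ := bit I.Y (c % I.n) h

/-- Three periods of `Y`: the tested column is taken from the middle one, and the outer ones leave
room for the vectors read before and after it. -/
def numBlocks (I : OVInstance) : ℕ := 3 * I.n * (I.d + 1)

variable {σ : ℕ}

/-- The minimum only makes the map total; all symbols in use are at most `3`. -/
def toSym (hσ : 4 ≤ σ) (a : ℕ) : Fin σ := ⟨min a 3, by omega⟩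

theorem map_val_map_toSym (hσ : 4 ≤ σ) (l : List ℕ) (hl : ∀ a ∈ l, a ≤ 3) :
    (l.map (toSym hσ)).map Fin.val = l := by
  rw [List.map_map]
  conv_rhs => rw [← List.map_id l]
  refine List.map_congr_left fun a ha => ?_
  simpa [toSym] using hl a ha

/-- Consecutive blocks are completely joined; the edge number `k` encodes the block and the two
positions inside the blocks. -/
def graph (I : OVInstance) (hσ : 4 ≤ σ) : LabeledGraph σ where
  nodes := numBlocks I * 6
  edges := List.ofFn fun k : Fin (36 * (numBlocks I - 1)) =>
    (⟨6 * (k.val / 36) + k.val % 36 / 6, by omega⟩, ⟨6 * (k.val / 36) + 6 + k.val % 6, by omega⟩)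
  edges_nodup := by
    rw [List.nodup_ofFn]
    intro k l h
    simp only [Prod.mk.injEq, Fin.mk.injEq] at h
    ext
    omega
  label v := (nodeLabel I.d (colBit I) v).map (toSym hσ)

def matchInstance (I : OVInstance) (hσ : 4 ≤ σ) : MatchInstance σ where
  G := graph I hσ
  Q := (query (vectors I.X)).map (toSym hσ)

theorem mem_edges (I : OVInstance) (hσ : 4 ≤ σ) (v w : Fin (graph I hσ).nodes) :
    (v, w) ∈ (graph I hσ).edges ↔ w.val / 6 = v.val / 6 + 1 := by
  have hv : v.val < numBlocks I * 6 := v.2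
  have hw : w.val < numBlocks I * 6 := w.2
  refine List.mem_ofFn.trans ?_
  constructor
  · rintro ⟨k, h⟩
    have h₁ := congrArg (fun e => e.1.val) h
    have h₂ := congrArg (fun e => e.2.val) h
    simp only at h₁ h₂
    omega
  · intro h
    exact ⟨⟨36 * (v.val / 6) + 6 * (v.val % 6) + w.val % 6, by omega⟩, 
      Prod.ext (Fin.ext (by simp only; omega)) (Fin.ext (by simp only; omega))⟩

theorem colBit_le_one (I : OVInstance) (c h : ℕ) : colBit I c h ≤ 1 := bit_le_one _ _ _

theorem nodeLabel_le_three (I : OVInstance) (v : ℕ) : ∀ a ∈ nodeLabel I.d (colBit I) v, a ≤ 3 := by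
  have hv : v % 6 < 6 := Nat.mod_lt _ (by norm_num)
  rcases delimLabel_or_coordLabel (d := I.d) (colBit_le_one I) v with ⟨-, h⟩ | ⟨b, hb, h⟩
  · rw [h]; revert hv; generalize v % 6 = r; intro hv
    interval_cases r <;> decide
  · rw [h]; revert hv; generalize v % 6 = r; intro hv
    interval_cases b <;> interval_cases r <;> decide

theorem nodeLabel_length (I : OVInstance) (v : ℕ) : nodeLabel I.d (colBit I) v ≠ [] ∧
    (nodeLabel I.d (colBit I) v).length ≤ 4 := by
  have hv : v % 6 < 6 := Nat.mod_lt _ (by norm_num)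
  rcases delimLabel_or_coordLabel (d := I.d) (colBit_le_one I) v with ⟨-, h⟩ | ⟨b, hb, h⟩
  · rw [h]; revert hv; generalize v % 6 = r; intro hv
    interval_cases r <;> decide
  · rw [h]; revert hv; generalize v % 6 = r; intro hv
    interval_cases b <;> interval_cases r <;> decide

theorem coordLabel_inj {y r s : ℕ} (hy : y ≤ 1) (hr : r < 6) (hs : s < 6)
    (h : coordLabel y r = coordLabel y s) : r = s := by
  interval_cases y <;> interval_cases r <;> interval_cases s <;>
    first | rfl | exact absurd h (by decide)

theorem delimLabel_inj {r s : ℕ} (hr : r < 6) (hs : s < 6)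
    (h : delimLabel r = delimLabel s) : r = s := by
  interval_cases r <;> interval_cases s <;> first | rfl | exact absurd h (by decide)

theorem nodeLabel_inj (I : OVInstance) {v w : ℕ} (hb : v / 6 = w / 6)
    (h : nodeLabel I.d (colBit I) v = nodeLabel I.d (colBit I) w) : v = w := by
  have hv : v % 6 < 6 := Nat.mod_lt _ (by norm_num)
  have hw : w % 6 < 6 := Nat.mod_lt _ (by norm_num)
  simp only [nodeLabel, hb, blockLabel] at h
  suffices v % 6 = w % 6 by omega
  split at h
  · exact delimLabel_inj hv hw h
  · exact coordLabel_inj (colBit_le_one I _ _) hv hw h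

theorem map_toSym_inj (hσ : 4 ≤ σ) {l l' : List ℕ} (hl : ∀ a ∈ l, a ≤ 3) (hl' : ∀ a ∈ l', a ≤ 3)
    (h : l.map (toSym hσ) = l'.map (toSym hσ)) : l = l' := by
  rw [← map_val_map_toSym hσ l hl, h, map_val_map_toSym hσ l' hl']

/-! ### The multiple sequence alignment -/

theorem spell_append {m n : ℕ} (M : MSA σ m n) (t : Fin m) {x y z : ℕ} (hxy : x ≤ y) (hyz : y ≤ z) :
    M.spell t x z = M.spell t x y ++ M.spell t y z := by
  simp only [MSA.spell]
  rw [← List.reduceOption_append, show z - x = (y - x) + (z - y) by omega, List.take_add,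
    List.drop_drop, show x + (y - x) = y by omega]

/-- Row `t` passes through node `t / 6` in even blocks, through node `t % 6` in odd blocks. -/
def rowNode (t b : ℕ) : ℕ := if b % 2 = 0 then t / 6 else t % 6

/-- Every block takes four columns, the maximal label length; shorter labels are padded with gaps at
the end, where the lookup returns `none`. -/
def alignment (I : OVInstance) (hσ : 4 ≤ σ) : MSA σ 36 (4 * numBlocks I) := fun t col =>
  ((nodeLabel I.d (colBit I) (6 * (col.val / 4) + rowNode t (col.val / 4)))[col.val % 4]?).map
    (toSym hσ)

theorem spell_alignment (I : OVInstance) (hσ : 4 ≤ σ) (t : Fin 36) {b : ℕ} (hb : b < numBlocks I) :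
    (alignment I hσ).spell t (4 * b) (4 * (b + 1)) =
      (nodeLabel I.d (colBit I) (6 * b + rowNode t b)).map (toSym hσ) := by
  have hl := (nodeLabel_length I (6 * b + rowNode t b)).2
  set l := nodeLabel I.d (colBit I) (6 * b + rowNode t b) with hldef
  have h1 : ((List.ofFn ((alignment I hσ) t)).drop (4 * b)).take (4 * (b + 1) - 4 * b) =
      [l[0]?.map (toSym hσ), l[1]?.map (toSym hσ), l[2]?.map (toSym hσ),
        l[3]?.map (toSym hσ)] := by
    rw [show 4 * (b + 1) - 4 * b = 4 by omega]
    apply List.ext_getElem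
    · simp; omega
    · intro j h₁ h₂
      have hj : j < 4 := h₂
      have e1 : (4 * b + j) / 4 = b := by omega
      have e2 : (4 * b + j) % 4 = j := by omega
      simp only [List.getElem_take, List.getElem_drop, List.getElem_ofFn, alignment, e1, e2]
      rw [← hldef]
      interval_cases j <;> rfl
  rw [MSA.spell, h1]
  clear_value l
  match l, hl with
  | [], _ => rfl
  | [_], _ => rfl
  | [_, _], _ => rfl
  | [_, _, _], _ => rfl
  | [_, _, _, _], _ => rfl
  | _ :: _ :: _ :: _ :: _ :: _, h => simp at h; omega

theorem rowNode_lt (t : Fin 36) (b : ℕ) : rowNode t b < 6 := by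
  have := t.2
  unfold rowNode
  split <;> omega

theorem isElasticFounderGraph_graph (I : OVInstance) (hI : I.Valid) (hσ : 4 ≤ σ) :
    (graph I hσ).IsElasticFounderGraph := by
  have hpos : 0 < numBlocks I := by
    have := hI.1; unfold numBlocks; positivity
  refine ⟨36, 4 * numBlocks I, alignment I hσ, numBlocks I, fun k => 4 * k, fun v => v.val / 6,
    by norm_num, by omega, rfl, rfl, fun k _ => by omega, ?_, ?_, ?_, ?_, ?_⟩
  · intro k hk t
    simp only [spell_alignment I hσ t hk, ne_eq, List.map_eq_nil_iff]
    exact (nodeLabel_length I _).1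
  · intro v
    have : v.val < numBlocks I * 6 := v.2
    omega
  · intro k hk
    ext w
    simp only [spell_alignment I hσ _ hk, Set.mem_ofPred_eq]
    constructor
    · rintro ⟨t, rfl⟩
      have := rowNode_lt t k
      exact ⟨⟨6 * k + rowNode t k, by simp only [graph]; omega⟩, by simp only; omega, rfl⟩
    · rintro ⟨v, hv, rfl⟩
      -- Row `7 * r = 6 * r + r` passes through the node `r` in blocks of either parity.
      refine ⟨⟨7 * (v.val % 6), by omega⟩, ?_⟩
      simp only [graph]
      congr 2
      simp only [rowNode]
      split <;> omega
  · intro v w hb h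
    exact Fin.ext (nodeLabel_inj I hb
      (map_toSym_inj hσ (nodeLabel_le_three I _) (nodeLabel_le_three I _) h))
  · intro v w
    rw [mem_edges]
    refine ⟨fun h => ⟨h, ?_⟩, fun h => h.1⟩
    have hw : w.val < numBlocks I * 6 := w.2
    -- The two base-six digits of a row number are its positions in even and in odd blocks, so the
    -- parity of the block of `v` decides their order.
    refine ⟨if v.val / 6 % 2 = 0 then ⟨6 * (v.val % 6) + w.val % 6, by omega⟩
      else ⟨6 * (w.val % 6) + v.val % 6, by omega⟩, ?_⟩
    rw [spell_append _ _ (y := 4 * (v.val / 6 + 1)) (by omega) (by omega),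
      spell_alignment I hσ _ (by omega), show v.val / 6 + 2 = v.val / 6 + 1 + 1 by ring,
      spell_alignment I hσ _ (by omega)]
    simp only [graph]
    congr 3
    · simp only [rowNode]
      split <;> simp only <;> omega
    · simp only [rowNode]
      split_ifs <;> simp only <;> omega

/-! ### Correctness of the reduction -/

theorem orthogonal_iff (I : OVInstance) (i j : ℕ) (hi : i < I.n) (hj : j < I.n) :
    Orthogonal I.d ((List.range I.d).map fun h => bit I.X i h) (fun h => bit I.Y j h) ↔
      ∑ h, (I.X ⟨i, hi⟩ h).toNat * (I.Y ⟨j, hj⟩ h).toNat = 0 := by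
  simp only [Orthogonal, Finset.sum_eq_zero_iff, Finset.mem_univ, true_implies]
  constructor
  · intro H h
    have := H h h.2
    simpa [bit, hi, hj] using this
  · intro H h hh
    have := H ⟨h, hh⟩
    simpa [bit, hi, hj, hh] using this

theorem vectors_length {n d : ℕ} (Z : Fin n → Fin d → Bool) : ∀ x ∈ vectors Z, x.length = d := by
  simp [vectors]

theorem vectors_le_one {n d : ℕ} (Z : Fin n → Fin d → Bool) : ∀ x ∈ vectors Z, ∀ b ∈ x, b ≤ 1 := by
  simp only [vectors, List.mem_map, List.mem_range]
  rintro x ⟨i, -, rfl⟩ b hb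
  obtain ⟨h, -, rfl⟩ := List.mem_map.1 hb
  exact bit_le_one _ _ _

theorem query_le_three (xs : List (List ℕ)) (hxs : ∀ x ∈ xs, ∀ b ∈ x, b ≤ 1) :
    ∀ a ∈ query xs, a ≤ 3 := by
  suffices H : ∀ a ∈ queryTail xs, a ≤ 3 by
    intro a ha
    simp only [query, List.mem_cons] at ha
    rcases ha with rfl | rfl | ha
    · omega
    · omega
    · exact H a ha
  induction xs with
  | nil => simp [queryTail]
  | cons x xs ih =>
    intro a ha
    simp only [queryTail, List.mem_cons, List.mem_append, List.mem_flatMap, List.not_mem_nil,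
      or_false] at ha
    rcases ha with rfl | rfl | ⟨b, hb, rfl | rfl | rfl⟩ | rfl | ha
    any_goals omega
    · have := hxs x (by simp) a hb; omega
    · exact ih (fun x hx => hxs x (by simp [hx])) a ha

theorem flatMap_label (I : OVInstance) (hσ : 4 ≤ σ) (p : List (Fin (graph I hσ).nodes)) :
    p.flatMap (graph I hσ).label =
      ((p.map Fin.val).flatMap (nodeLabel I.d (colBit I))).map (toSym hσ) := by
  rw [List.map_flatMap, List.flatMap_map]
  rfl

theorem matches_query_iff (I : OVInstance) (hI : I.Valid) (hσ : 4 ≤ σ) :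
    (graph I hσ).Matches ((query (vectors I.X)).map (toSym hσ)) ↔ I.HasOrthogonalPair := by
  obtain ⟨hn, hd⟩ := hI
  constructor
  · rintro ⟨p, ⟨hne, hchain⟩, hinf⟩
    have h1 := hinf.map Fin.val
    rw [map_val_map_toSym hσ _ (query_le_three _ (vectors_le_one _)), flatMap_label,
      map_val_map_toSym hσ _ (by
        intro a ha
        obtain ⟨v, -, hv⟩ := List.mem_flatMap.1 ha
        exact nodeLabel_le_three I v a hv)] at h1
    have h2 : (p.map Fin.val).IsChain fun v w => w / 6 = v / 6 + 1 := by
      rw [List.isChain_map]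
      exact hchain.imp fun v w h => (mem_edges I hσ v w).1 h
    obtain ⟨k, hk⟩ : ∃ k, Consecutive k (p.map Fin.val) := by
      match p, h2 with
      | [], _ => exact ⟨0, trivial⟩
      | v :: p, h2 => exact ⟨_, consecutive_of_isChain h2⟩
    obtain ⟨x, hx, c, hc⟩ := exists_orthogonal_of_query_infix (colBit_le_one I) (vectors I.X)
      (vectors_length _) (vectors_le_one _) k _ hk h1
    simp only [vectors, List.mem_map, List.mem_range] at hx
    obtain ⟨i, hi, rfl⟩ := hx
    exact ⟨⟨i, hi⟩, ⟨c % I.n, Nat.mod_lt _ hn⟩, (orthogonal_iff I i _ hi _).1 hc⟩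
  · rintro ⟨i, j, hij⟩
    have hO := (orthogonal_iff I i j i.2 j.2).2 hij
    have hi := i.2
    have hj := j.2
    set x := (List.range I.d).map fun h => bit I.X i h with hx
    have hsplit : vectors I.X = (vectors I.X).take i ++ x :: (vectors I.X).drop (i + 1) := by
      have hlen : i.val < (vectors I.X).length := by simp [vectors]
      have hget : (vectors I.X)[i.val] = x := by simp [vectors, hx]
      rw [← hget, List.cons_getElem_drop_succ, List.take_append_drop]
    -- The vector `x` with index `i` is read in column `c + 1 + i`, which is to be the copy of `j`
    -- in the middle period. Then `c` is nonnegative and the match ends before column `3 * I.n`.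
    obtain ⟨c, hc⟩ : ∃ c, c + 1 + i = I.n + j := ⟨I.n + j - 1 - i, by omega⟩
    have hcn : c + I.n + 2 ≤ 3 * I.n := by omega
    have htl : ((vectors I.X).take i).length = i := by simp [vectors]
    have hdl : ((vectors I.X).drop (i + 1)).length = I.n - (i + 1) := by simp [vectors]
    obtain ⟨p, hpl, hp, hinf⟩ := exists_path_query (d := I.d) (y := colBit I) hd
      ((vectors I.X).take i) x ((vectors I.X).drop (i + 1))
      (hsplit ▸ vectors_length I.X) (hsplit ▸ vectors_le_one I.X) c (by
        rw [htl, hc]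
        have : colBit I (I.n + j) = fun h => bit I.Y j h := by
          ext h; simp [colBit, Nat.mod_eq_of_lt hj]
        rwa [this])
    rw [← hsplit] at hinf
    have hlt : ∀ v ∈ p, v < (graph I hσ).nodes := by
      intro v hv
      change v < numBlocks I * 6
      have h1 := hp.lt hv
      rw [hpl, htl, hdl, show i.val + (I.n - (i.val + 1)) + 1 = I.n by omega] at h1
      have h2 : (c + I.n + 2) * (I.d + 1) ≤ 3 * I.n * (I.d + 1) := Nat.mul_le_mul_right _ hcn
      have h3 : (c + I.n + 2) * (I.d + 1) = c * (I.d + 1) + I.n * (I.d + 1) + 2 * I.d + 2 := by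
        ring
      simp only [numBlocks]
      omega
    obtain ⟨q, rfl⟩ : ∃ q : List (Fin (graph I hσ).nodes), q.map Fin.val = p :=
      ⟨p.pmap (fun v (h : v < (graph I hσ).nodes) => ⟨v, h⟩) hlt, by simp [List.map_pmap]⟩
    refine ⟨q, ⟨?_, ?_⟩, ?_⟩
    · rintro rfl
      simp at hpl
    · have := hp.isChain
      rw [List.isChain_map] at this
      exact this.imp fun v w h => (mem_edges I hσ v w).2 h
    · rw [flatMap_label]
      exact hinf.map (toSym hσ)

theorem hasMatch_iff (I : OVInstance) (hI : I.Valid) (hσ : 4 ≤ σ) :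
    (matchInstance I hσ).HasMatch ↔ I.HasOrthogonalPair :=
  matches_query_iff I hI hσ

theorem valid_matchInstance (I : OVInstance) (hI : I.Valid) (hσ : 4 ≤ σ) :
    (matchInstance I hσ).Valid :=
  ⟨isElasticFounderGraph_graph I hI hσ, by simp [matchInstance, query]⟩

end OVReduction

namespace WordRAM

/-! ### Notation for expressions -/

namespace WordExpr

instance (n : ℕ) : OfNat WordExpr n := ⟨.lit n⟩
instance : Add WordExpr := ⟨.op .add⟩
instance : Sub WordExpr := ⟨.op .sub⟩
instance : Mul WordExpr := ⟨.op .mul⟩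
instance : Div WordExpr := ⟨.op .div⟩
instance : Mod WordExpr := ⟨.op .mod⟩

variable (rd ρ : ℕ → ℕ) (A : ℕ → Prop) (r : ℕ) (a b : WordExpr)

@[simp] theorem eval_ofNat (n : ℕ) :
    (no_index (OfNat.ofNat n : WordExpr)).eval rd ρ = OfNat.ofNat n := rfl
@[simp] theorem eval_var (i : ℕ) : (var i).eval rd ρ = ρ i := rfl
@[simp] theorem eval_load : (load a).eval rd ρ = rd (a.eval rd ρ) := rfl
@[simp] theorem eval_add : (a + b).eval rd ρ = a.eval rd ρ + b.eval rd ρ := rfl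
@[simp] theorem eval_sub : (a - b).eval rd ρ = a.eval rd ρ - b.eval rd ρ := rfl
@[simp] theorem eval_mul : (a * b).eval rd ρ = a.eval rd ρ * b.eval rd ρ := rfl
@[simp] theorem eval_div : (a / b).eval rd ρ = a.eval rd ρ / b.eval rd ρ := rfl
@[simp] theorem eval_mod : (a % b).eval rd ρ = a.eval rd ρ % b.eval rd ρ := rfl

@[simp] theorem ok_ofNat (n : ℕ) : (no_index (OfNat.ofNat n : WordExpr)).Ok A rd ρ r := trivial
@[simp] theorem ok_var (i : ℕ) : (var i).Ok A rd ρ r ↔ 1 ≤ i ∧ i < r := Iff.rfl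
@[simp] theorem ok_load : (load a).Ok A rd ρ r ↔ a.Ok A rd ρ r ∧ A (a.eval rd ρ) := Iff.rfl
@[simp] theorem ok_add : (a + b).Ok A rd ρ r ↔ a.Ok A rd ρ r ∧ b.Ok A rd ρ r :=
  ⟨fun h => h.2, fun h => ⟨BinOp.tame_add, h⟩⟩
@[simp] theorem ok_sub : (a - b).Ok A rd ρ r ↔ a.Ok A rd ρ r ∧ b.Ok A rd ρ r :=
  ⟨fun h => h.2, fun h => ⟨BinOp.tame_sub, h⟩⟩
@[simp] theorem ok_mul : (a * b).Ok A rd ρ r ↔ a.Ok A rd ρ r ∧ b.Ok A rd ρ r :=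
  ⟨fun h => h.2, fun h => ⟨BinOp.tame_mul, h⟩⟩
@[simp] theorem ok_div : (a / b).Ok A rd ρ r ↔ a.Ok A rd ρ r ∧ b.Ok A rd ρ r :=
  ⟨fun h => h.2, fun h => ⟨BinOp.tame_div, h⟩⟩
@[simp] theorem ok_mod : (a % b).Ok A rd ρ r ↔ a.Ok A rd ρ r ∧ b.Ok A rd ρ r :=
  ⟨fun h => h.2, fun h => ⟨BinOp.tame_mod, h⟩⟩

end WordExpr

namespace EmitCmd

def emitAll : WordExpr → List WordExpr → EmitCmd
  | e, [] => emit e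
  | e, e' :: l => seq (emit e) (emitAll e' l)

variable (rd ρ : ℕ → ℕ) (A : ℕ → Prop) (r : ℕ) (e : WordExpr) (c c' : EmitCmd)

@[simp] theorem out_emitAll (l : List WordExpr) :
    (emitAll e l).out rd r ρ = (e :: l).map (WordExpr.eval rd ρ) := by
  induction l generalizing e with
  | nil => rfl
  | cons e' l ih => simp only [emitAll, out, ih]; rfl

@[simp] theorem ok_emitAll (l : List WordExpr) :
    (emitAll e l).Ok A rd r ρ ↔ ∀ x ∈ e :: l, x.Ok A rd ρ r := by
  induction l generalizing e with
  | nil => simp [emitAll, Ok]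
  | cons e' l ih => simp only [emitAll, Ok, ih, List.forall_mem_cons]

@[simp] theorem steps_emitAll (l : List WordExpr) :
    (emitAll e l).steps rd r ρ = l.length + 1 := by
  induction l generalizing e with
  | nil => rfl
  | cons e' l ih => simp only [emitAll, steps, ih, List.length_cons]; omega

end EmitCmd

end WordRAM

namespace OVReduction

open WordRAM

/-! ### The encodings -/

theorem flatMap_range_mul {α : Type*} (a b : ℕ) (f : ℕ → List α) :
    (List.range (a * b)).flatMap f =
      (List.range a).flatMap fun i => (List.range b).flatMap fun j => f (i * b + j) := by
  induction a with
  | zero => simp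
  | succ a ih =>
    rw [Nat.succ_mul, List.range_add, List.range_succ, List.flatMap_append, List.flatMap_append, ih,
      List.flatMap_map]
    simp

theorem flatten_ofFn {α : Type*} {n : ℕ} (f : ℕ → List α) :
    (List.ofFn fun i : Fin n => f i).flatten = (List.range n).flatMap f := by
  rw [List.flatMap_def]
  congr 1
  apply List.ext_getElem <;> simp

theorem vectorWords_eq {n d : ℕ} (Z : Fin n → Fin d → Bool) :
    OVInstance.vectorWords Z = (List.range (n * d)).map fun k => bit Z (k / d) (k % d) := by
  have h1 : OVInstance.vectorWords Z =
      (List.ofFn fun i : Fin n => (List.range d).map fun h => bit Z i h).flatten := by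
    unfold OVInstance.vectorWords
    congr 2
    ext1 i
    apply List.ext_getElem
    · simp
    · intro j h₁ h₂
      have hj : j < d := by simpa using h₁
      simp [bit, hj]
  rw [h1, flatten_ofFn (fun i => (List.range d).map fun h => bit Z i h),
    ← List.flatMap_pure_eq_map _ (List.range (n * d)), flatMap_range_mul]
  refine List.flatMap_congr fun i _ => ?_
  rw [← List.flatMap_pure_eq_map]
  refine List.flatMap_congr fun h hh => ?_
  rw [List.mem_range] at hh
  simp only [Function.comp]
  rw [add_comm, Nat.add_mul_div_right _ _ (by omega), Nat.div_eq_of_lt hh,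
    Nat.add_mul_mod_self_right, Nat.mod_eq_of_lt hh, zero_add]

/-- The words of the two families. -/
def inputBits (I : OVInstance) : List ℕ :=
  OVInstance.vectorWords I.X ++ OVInstance.vectorWords I.Y

theorem length_vectorWords {n d : ℕ} (Z : Fin n → Fin d → Bool) :
    (OVInstance.vectorWords Z).length = n * d := by
  rw [vectorWords_eq]; simp

theorem length_inputBits (I : OVInstance) : (inputBits I).length = 2 * (I.n * I.d) := by
  simp only [inputBits, List.length_append, length_vectorWords]; ring

theorem getD_vectorWords {n d : ℕ} (Z : Fin n → Fin d → Bool) {i h : ℕ} (hi : i < n) (hh : h < d) :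
    (OVInstance.vectorWords Z).getD (i * d + h) 0 = bit Z i h := by
  have hlt : i * d + h < n * d := by nlinarith
  rw [vectorWords_eq, List.getD_eq_getElem _ _ (by simpa using hlt), List.getElem_map,
    List.getElem_range, add_comm, Nat.add_mul_div_right _ _ (by omega), Nat.div_eq_of_lt hh,
    Nat.add_mul_mod_self_right, Nat.mod_eq_of_lt hh, zero_add]

theorem getD_inputBits_left (I : OVInstance) {i h : ℕ} (hi : i < I.n) (hh : h < I.d) :
    (inputBits I).getD (i * I.d + h) 0 = bit I.X i h := by
  have hlt : i * I.d + h < I.n * I.d := by nlinarith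
  rw [inputBits, List.getD_append _ _ _ _ (by rwa [length_vectorWords]), getD_vectorWords _ hi hh]

theorem getD_inputBits_right (I : OVInstance) {i h : ℕ} (hi : i < I.n) (hh : h < I.d) :
    (inputBits I).getD (I.n * I.d + (i * I.d + h)) 0 = bit I.Y i h := by
  rw [inputBits, List.getD_append_right _ _ _ _ (by rw [length_vectorWords]; omega),
    length_vectorWords, Nat.add_sub_cancel_left, getD_vectorWords _ hi hh]

theorem inputBits_le_one (I : OVInstance) (k : ℕ) : (inputBits I).getD k 0 ≤ 1 := by
  rcases Nat.lt_or_ge k (inputBits I).length with hk | hk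
  · rw [List.getD_eq_getElem _ _ hk]
    have hm := List.getElem_mem hk
    generalize (inputBits I)[k] = b at *
    simp only [inputBits, vectorWords_eq, List.mem_append, List.mem_map] at hm
    rcases hm with ⟨_, -, rfl⟩ | ⟨_, -, rfl⟩ <;> exact bit_le_one _ _ _
  · rw [List.getD_eq_default _ _ hk]; omega

theorem encode_eq (I : OVInstance) : I.encode = I.n :: I.d :: inputBits I := by
  simp [OVInstance.encode, inputBits]

def queryLength (I : OVInstance) : ℕ := 3 + I.n * (3 + 3 * I.d)

/-- The encoding of the instance of the matching problem. -/
def outputWords (I : OVInstance) : List ℕ :=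
  [numBlocks I * 6, 36 * (numBlocks I - 1), queryLength I] ++
    -- The labels of a block, each preceded by its length: 23 words for a delimiter block, 24 for a
    -- coordinate block.
    ((List.range (3 * I.n)).flatMap fun c =>
      [3, 3, 2, 2, 2, 3, 2, 2, 2, 3, 3, 2, 2, 3, 3, 2, 3, 2, 4, 2, 2, 3, 2] ++
        (List.range I.d).flatMap fun h =>
          [3, 0, 2, 2, 3, 1, 2, 2, 3, 2, 0, 2, 3, 2, 1 + colBit I c h, 2, 3, 2, 2, 0, 3, 2, 2, 1]) ++
    ((List.range (36 * (numBlocks I - 1))).flatMap fun k =>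
      [6 * (k / 36) + k % 36 / 6, 6 * (k / 36) + 6 + k % 6]) ++
    ([0] ++ ((List.range I.n).flatMap fun i =>
      [3, 2, 2] ++ (List.range I.d).flatMap fun h => [bit I.X i h, 2, 2]) ++ [3, 0])

def outputLength (I : OVInstance) : ℕ :=
  3 + 3 * I.n * (23 + 24 * I.d) + 2 * (36 * (numBlocks I - 1)) + queryLength I

theorem sum_map_const_range (n k : ℕ) : ((List.range n).map fun _ => k).sum = n * k := by
  simp

theorem length_outputWords (I : OVInstance) : (outputWords I).length = outputLength I := by
  simp only [outputWords, outputLength, queryLength, List.length_append, List.length_flatMap,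
    List.length_cons, List.length_nil, sum_map_const_range]
  ring

/-- Moving each delimiter to the front of its vector turns the recursive query into a concatenation
of uniform pieces, which a loop can emit. -/
theorem three_cons_queryTail (xs : List (List ℕ)) :
    3 :: queryTail xs =
      (xs.flatMap fun x => [3, 2, 2] ++ x.flatMap fun b => [b, 2, 2]) ++ [3, 0] := by
  induction xs with
  | nil => rfl
  | cons x xs ih => simp [queryTail, ih]

theorem query_vectors (I : OVInstance) : query (vectors I.X) =
    [0] ++ ((List.range I.n).flatMap fun i =>
      [3, 2, 2] ++ (List.range I.d).flatMap fun h => [bit I.X i h, 2, 2]) ++ [3, 0] := by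
  rw [query, three_cons_queryTail, vectors, List.flatMap_map]
  simp only [List.flatMap_map, List.cons_append, List.nil_append]

theorem length_query_vectors (I : OVInstance) :
    (query (vectors I.X)).length = queryLength I := by
  rw [query_vectors]
  simp only [queryLength, List.length_append, List.length_flatMap,
    List.length_cons, List.length_nil, sum_map_const_range]
  ring

theorem flatMap_nodeLabel (I : OVInstance) :
    (List.range (numBlocks I * 6)).flatMap (fun v => (nodeLabel I.d (colBit I) v).length ::
      nodeLabel I.d (colBit I) v) =
    (List.range (3 * I.n)).flatMap fun c =>
      [3, 3, 2, 2, 2, 3, 2, 2, 2, 3, 3, 2, 2, 3, 3, 2, 3, 2, 4, 2, 2, 3, 2] ++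
        (List.range I.d).flatMap fun h =>
          [3, 0, 2, 2, 3, 1, 2, 2, 3, 2, 0, 2, 3, 2, 1 + colBit I c h, 2, 3, 2, 2, 0,
            3, 2, 2, 1] := by
  have key : ∀ b, (List.range 6).flatMap (fun r => (nodeLabel I.d (colBit I) (b * 6 + r)).length ::
      nodeLabel I.d (colBit I) (b * 6 + r)) = (List.range 6).flatMap (fun r =>
      (blockLabel I.d (colBit I) b r).length :: blockLabel I.d (colBit I) b r) := by
    intro b
    refine List.flatMap_congr fun r hr => ?_
    rw [List.mem_range] at hr
    rw [nodeLabel, show (b * 6 + r) / 6 = b by omega, show (b * 6 + r) % 6 = r by omega]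
  rw [flatMap_range_mul]
  simp only [key]
  rw [numBlocks, flatMap_range_mul]
  refine List.flatMap_congr fun c _ => ?_
  rw [List.range_succ_eq_map (n := I.d), List.flatMap_cons, List.flatMap_map]
  congr 1
  · simp only [add_zero, blockLabel_delim]; rfl
  · refine List.flatMap_congr fun h hh => ?_
    rw [List.mem_range] at hh
    simp only [Nat.succ_eq_add_one, ← add_assoc, blockLabel_coord hh]
    rfl

variable {σ : ℕ}

theorem encode_matchInstance (I : OVInstance) (hσ : 4 ≤ σ) :
    (matchInstance I hσ).encode = outputWords I := by
  have h1 : (List.ofFn fun v : Fin (graph I hσ).nodes => ((graph I hσ).label v).length ::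
      MatchInstance.stringWords ((graph I hσ).label v)).flatten =
      (List.range (numBlocks I * 6)).flatMap (fun v => (nodeLabel I.d (colBit I) v).length ::
        nodeLabel I.d (colBit I) v) := by
    rw [← flatten_ofFn]
    change (List.ofFn fun v : Fin (numBlocks I * 6) => _).flatten = _
    congr 2
    ext1 v
    simp only [graph, MatchInstance.stringWords, List.length_map]
    rw [map_val_map_toSym hσ _ (nodeLabel_le_three I _)]
  have h2 : ((graph I hσ).edges.flatMap fun e => [e.1.val, e.2.val]) =
      (List.range (36 * (numBlocks I - 1))).flatMap fun k =>
        [6 * (k / 36) + k % 36 / 6, 6 * (k / 36) + 6 + k % 6] := by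
    rw [← flatten_ofFn, List.flatMap_def]
    simp only [graph, List.map_ofFn]
    rfl
  have h3 : MatchInstance.stringWords ((query (vectors I.X)).map (toSym hσ)) =
      query (vectors I.X) :=
    map_val_map_toSym hσ _ (query_le_three _ (vectors_le_one _))
  have h4 : (graph I hσ).edges.length = 36 * (numBlocks I - 1) := List.length_ofFn
  have h5 : (graph I hσ).nodes = numBlocks I * 6 := rfl
  simp only [MatchInstance.encode, matchInstance]
  rw [h1, h2, h3, h4, h5, List.length_map, length_query_vectors, flatMap_nodeLabel, query_vectors]
  rfl

theorem size_matchInstance (I : OVInstance) (hσ : 4 ≤ σ) :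
    (matchInstance I hσ).size = outputLength I := by
  rw [MatchInstance.size, encode_matchInstance, length_outputWords]

theorem numEdges_matchInstance (I : OVInstance) (hσ : 4 ≤ σ) :
    (matchInstance I hσ).numEdges = 36 * (numBlocks I - 1) := List.length_ofFn

theorem queryLength_matchInstance (I : OVInstance) (hσ : 4 ≤ σ) :
    (matchInstance I hσ).queryLength = queryLength I := by
  rw [MatchInstance.queryLength, matchInstance, List.length_map, length_query_vectors]

/-! ### The program -/

/-- The number of blocks; register `1` holds `n`, register `2` holds `d`. -/
def blocksExpr : WordExpr := 3 * .var 1 * (.var 2 + 1)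

def edgesExpr : WordExpr := 36 * (blocksExpr - 1)

def queryLengthExpr : WordExpr := 3 + .var 1 * (3 + 3 * .var 2)

def outputLengthExpr : WordExpr :=
  3 + 3 * .var 1 * (23 + 24 * .var 2) + 2 * edgesExpr + queryLengthExpr

/-- Writes the encoding; register `3` holds the address of the bits of the input. -/
def outputCmd : EmitCmd :=
  .seq (.emitAll (blocksExpr * 6) [edgesExpr, queryLengthExpr]) <|
  .seq (.forN (3 * .var 1) <|
    .seq (.emitAll 3 [3, 2, 2, 2, 3, 2, 2, 2, 3, 3, 2, 2, 3, 3, 2, 3, 2, 4, 2, 2, 3, 2]) <|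
    .forN (.var 2) <|
      .emitAll 3 [0, 2, 2, 3, 1, 2, 2, 3, 2, 0, 2, 3, 2,
        -- Register `4` counts columns and register `7` coordinates, since a loop takes three
        -- registers. The bits of `Y` lie behind the `n * d` bits of `X`.
        1 + .load (.var 3 + (.var 1 * .var 2 + (.var 4 % .var 1 * .var 2 + .var 7))),
        2, 3, 2, 2, 0, 3, 2, 2, 1]) <|
  .seq (.forN edgesExpr <|
    .emitAll (6 * (.var 4 / 36) + .var 4 % 36 / 6) [6 * (.var 4 / 36) + 6 + .var 4 % 6]) <|
  .seq (.emit 0) <|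
  .seq (.forN (.var 1) <|
    .seq (.emitAll 3 [2, 2]) <|
    .forN (.var 2) <| .emitAll (.load (.var 3 + (.var 4 * .var 2 + .var 7))) [2, 2]) <|
  .emitAll 3 [0]

/-- The offset `2` skips the words `n` and `d`. -/
def copyCmd : EmitCmd := .forN (2 * (.var 1 * .var 2)) (.emit (.load (2 + .var 4)))

def eraseCmd : EmitCmd := .forN (2 * (.var 1 * .var 2)) (.emit 0)

/-- The values of the registers `1`, `2`, `3`. -/
def baseEnv (I : OVInstance) : ℕ → ℕ
  | 1 => I.n
  | 2 => I.d
  | 3 => outputLength I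
  | _ => 0

@[simp] theorem baseEnv_one (I : OVInstance) : baseEnv I 1 = I.n := rfl
@[simp] theorem baseEnv_two (I : OVInstance) : baseEnv I 2 = I.d := rfl
@[simp] theorem baseEnv_three (I : OVInstance) : baseEnv I 3 = outputLength I := rfl

theorem eval_outputLengthExpr (rd ρ : ℕ → ℕ) (I : OVInstance) (h1 : ρ 1 = I.n) (h2 : ρ 2 = I.d) :
    outputLengthExpr.eval rd ρ = outputLength I := by
  simp [outputLengthExpr, edgesExpr, blocksExpr, queryLengthExpr, outputLength, numBlocks,
    queryLength, h1, h2]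

/-- The memory contents read by `outputCmd`. -/
def bitsAt (I : OVInstance) (a : ℕ) : ℕ := (inputBits I).getD (a - outputLength I) 0

theorem out_outputCmd (I : OVInstance) :
    outputCmd.out (bitsAt I) 4 (baseEnv I) = outputWords I := by
  simp only [outputCmd, EmitCmd.out, EmitCmd.out_emitAll, List.map_cons, List.map_nil,
    WordExpr.eval_ofNat, WordExpr.eval_var, WordExpr.eval_load, WordExpr.eval_add,
    WordExpr.eval_sub, WordExpr.eval_mul, WordExpr.eval_div, WordExpr.eval_mod, edgesExpr,
    blocksExpr, queryLengthExpr, EmitCmd.loopEnv_self, EmitCmd.loopEnv_of_lt, Nat.reduceAdd,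
    Nat.reduceLT, baseEnv_one, baseEnv_two, baseEnv_three, bitsAt, Nat.add_sub_cancel_left]
  simp only [outputWords, List.append_assoc, numBlocks, queryLength]
  congr 1
  congr 1
  · refine List.flatMap_congr fun c hc => ?_
    congr 1
    refine List.flatMap_congr fun h hh => ?_
    rw [List.mem_range] at hc hh
    rw [getD_inputBits_right I (Nat.mod_lt _ (by omega)) hh]
    rfl
  · congr 2
    congr 1
    refine List.flatMap_congr fun i hi => ?_
    congr 1
    refine List.flatMap_congr fun h hh => ?_
    rw [List.mem_range] at hi hh
    rw [getD_inputBits_left I hi hh]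

theorem ok_outputCmd (I : OVInstance) :
    outputCmd.Ok (fun a => outputLength I ≤ a) (bitsAt I) 4 (baseEnv I) := by
  simp [outputCmd, EmitCmd.Ok, edgesExpr, blocksExpr, queryLengthExpr, EmitCmd.loopEnv_of_lt]

theorem steps_outputCmd (I : OVInstance) (hI : I.Valid) :
    outputCmd.steps (bitsAt I) 4 (baseEnv I) ≤ 2000 * (I.n * I.d) := by
  have h1 : I.n ≤ I.n * I.d := Nat.le_mul_of_pos_right _ hI.2
  have h2 : 1 ≤ I.n * I.d := Nat.mul_pos hI.1 hI.2
  simp only [outputCmd, EmitCmd.steps, EmitCmd.steps_emitAll, List.length_cons, List.length_nil,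
    edgesExpr, blocksExpr, WordExpr.eval_ofNat, WordExpr.eval_var, WordExpr.eval_add,
    WordExpr.eval_sub, WordExpr.eval_mul, EmitCmd.loopEnv_of_lt, Nat.reduceAdd, Nat.reduceLT,
    baseEnv_one, baseEnv_two, Finset.sum_const, Finset.card_range, smul_eq_mul]
  have h3 : 36 * (3 * I.n * (I.d + 1) - 1) ≤ 36 * (3 * I.n * (I.d + 1)) := by omega
  have h4 := Nat.mul_le_mul_right 3 h3
  nlinarith

theorem out_copyCmd (I : OVInstance) :
    copyCmd.out (initState I.encode).mem 4 (baseEnv I) = inputBits I := by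
  have : ∀ i, I.encode.getD (2 + i) 0 = (inputBits I).getD i 0 := fun i => by
    rw [encode_eq, add_comm]; rfl
  simp only [copyCmd, EmitCmd.out, WordExpr.eval_mul, WordExpr.eval_ofNat, WordExpr.eval_var,
    WordExpr.eval_load, WordExpr.eval_add, baseEnv_one, baseEnv_two, EmitCmd.loopEnv_self,
    initState, this]
  rw [← length_inputBits]
  generalize inputBits I = l
  apply List.ext_getElem
  · simp
  · intro j h₁ h₂
    rw [← List.getD_eq_getElem _ 0 h₁, ← List.getD_eq_getElem _ 0 h₂]
    rw [← List.map_eq_flatMap, List.getD_eq_getElem _ _ (by simpa using h₂)]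
    simp

theorem out_eraseCmd (I : OVInstance) (rd : ℕ → ℕ) :
    eraseCmd.out rd 4 (baseEnv I) = List.replicate (2 * (I.n * I.d)) 0 := by
  simp only [eraseCmd, EmitCmd.out, WordExpr.eval_mul, WordExpr.eval_ofNat, WordExpr.eval_var,
    baseEnv_one, baseEnv_two]
  generalize 2 * (I.n * I.d) = k
  induction k with
  | zero => rfl
  | succ k ih => rw [List.range_succ, List.flatMap_append, ih, List.replicate_succ']; rfl

/-- Sets the registers below `k` to zero. -/
def clearRegs : ℕ → Prog
  | 0 => .lit 0 0
  | k + 1 => .seq (clearRegs k) (.lit k 0)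

theorem exec_clearRegs {B : ℕ} (hB : 0 < B) (k : ℕ) (s : State) :
    ∃ s', Exec B (clearRegs k) s (k + 1) s' ∧ s'.mem = s.mem ∧ (∀ i < k, s'.reg i = 0) ∧
      ∀ i, k ≤ i → 1 ≤ i → s'.reg i = s.reg i := by
  induction k with
  | zero =>
    refine ⟨_, .lit hB, rfl, by simp, fun i _ hi => Function.update_of_ne (by omega) _ _⟩
  | succ k ih =>
    obtain ⟨s₁, e₁, m₁, z₁, p₁⟩ := ih
    refine ⟨_, .seq e₁ (.lit hB), m₁, fun i hi => ?_, fun i h1 h2 => ?_⟩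
    · simp only [State.setReg, Function.update_apply]
      split
      · rfl
      · exact z₁ i (by omega)
    · simp only [State.setReg]
      rw [Function.update_of_ne (by omega), p₁ i (by omega) h2]

/-- Reads `n` and `d` and computes the length of the output. -/
def setupProg : Prog :=
  .seq (.load 1 0) <| .seq (.lit 2 1) <| .seq (.load 2 2) <|
    .seq (outputLengthExpr.compile 3) (.op .lor 0 3 3)

/-- Replaces the input by the output. -/
def rewriteProg : Prog :=
  .seq setupProg <| .seq (copyCmd.compile 4) <| .seq (.lit 0 0) <|
    .seq (outputCmd.compile 4) (eraseCmd.compile 4)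

/-- The reduction from orthogonal vectors to matching. -/
def reductionProg : Prog := .seq rewriteProg (clearRegs (rewriteProg.regBound + 1))

theorem outputLength_le (I : OVInstance) (hI : I.Valid) :
    outputLength I ≤ 600 * (I.n * I.d) ∧ 2 + 2 * (I.n * I.d) ≤ outputLength I := by
  have h1 : I.n ≤ I.n * I.d := Nat.le_mul_of_pos_right _ hI.2
  have h2 : 1 ≤ I.n * I.d := Nat.mul_pos hI.1 hI.2
  have h3 : 3 * I.n * (23 + 24 * I.d) = 69 * I.n + 72 * (I.n * I.d) := by ring
  have h4 : 3 * I.n * (I.d + 1) = 3 * (I.n * I.d) + 3 * I.n := by ring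
  have h5 : I.n * (3 + 3 * I.d) = 3 * I.n + 3 * (I.n * I.d) := by ring
  simp only [outputLength, queryLength, numBlocks, h3, h4, h5]
  omega

theorem length_encode (I : OVInstance) : I.encode.length = 2 + 2 * (I.n * I.d) := by
  rw [encode_eq, List.length_cons, List.length_cons, length_inputBits]; ring

end OVReduction

/-! ### Correctness of the reduction program -/

namespace OVReduction

open WordRAM

theorem exists_exec_setupProg {B : ℕ} (I : OVInstance) (hI : I.Valid) {M : ℕ}
    (hM : M = I.encode.length + 2) (hB : M ^ (outputLengthExpr.deg 5 + 5) < B) :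
    ∃ s, Exec B setupProg (initState I.encode) (outputLengthExpr.steps + 4) s ∧
      s.mem = (initState I.encode).mem ∧ s.reg 0 = outputLength I ∧
      ∀ i, 1 ≤ i → i < 4 → s.reg i = baseEnv I i := by
  rw [length_encode] at hM
  have hM2 : 2 ≤ M := by omega
  have hle : ∀ k ≤ outputLengthExpr.deg 5 + 5, M ^ k < B := fun k hk =>
    (Nat.pow_le_pow_right (by omega) hk).trans_lt hB
  have hMB : M < B := by simpa using hle 1 (by omega)
  have hM5 : M ≤ M ^ 5 := Nat.le_self_pow (by norm_num) M
  have hn : I.n < M := by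
    have : I.n ≤ I.n * I.d := Nat.le_mul_of_pos_right _ hI.2
    omega
  have hd : I.d < M := by
    have : I.d ≤ I.n * I.d := Nat.le_mul_of_pos_left _ hI.1
    omega
  have m0 : (initState I.encode).mem 0 = I.n := by simp [initState, encode_eq]
  have m1 : (initState I.encode).mem 1 = I.d := by simp [initState, encode_eq]
  -- The words `n` and `d` are in the cells `0` and `1`; register `0` is still zero and serves as
  -- the first address.
  let s₀ := initState I.encode
  let s₁ := s₀.setReg 1 I.n
  let s₂ := s₁.setReg 2 1
  let s₃ := s₂.setReg 2 I.d
  have e₁ : Exec B (.load 1 0) s₀ 1 s₁ := by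
    have h := Exec.load (B := B) (r := 1) (a := 0) (s := s₀)
      (by rw [show s₀.mem (s₀.reg 0) = I.n from m0]; omega)
    rwa [show s₀.mem (s₀.reg 0) = I.n from m0] at h
  have e₂ : Exec B (.lit 2 1) s₁ 1 s₂ := .lit (by omega)
  have hs2 : s₂.mem (s₂.reg 2) = I.d := by
    simpa [s₂, s₁, s₀, State.setReg] using m1
  have e₃ : Exec B (.load 2 2) s₂ 1 s₃ := by
    have h := Exec.load (B := B) (r := 2) (a := 2) (s := s₂) (by rw [hs2]; omega)
    rwa [hs2] at h
  have r1 : s₃.reg 1 = I.n := by simp [s₃, s₂, s₁, State.setReg]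
  have r2 : s₃.reg 2 = I.d := by simp [s₃, State.setReg]
  obtain ⟨s₄, e₄, m₄, p₄, v₄⟩ := outputLengthExpr.exists_exec (A := fun _ => False) (rd := fun _ => 0)
    (ρ := s₃.reg) (r := 3) (D := 5) (B := B) (s := s₃) hM2 (hle _ (by omega))
    (by
      intro i h1 h2
      obtain rfl | rfl : i = 1 ∨ i = 2 := by omega
      · rw [r1]; omega
      · rw [r2]; omega)
    (fun _ h => h.elim) (by simp [outputLengthExpr, edgesExpr, blocksExpr, queryLengthExpr])
    le_rfl (fun _ _ _ => rfl) (fun _ h => h.elim)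
  rw [eval_outputLengthExpr _ _ I r1 r2] at v₄
  have hS : outputLength I < B := by
    have h1 := (outputLength_le I hI).1
    have h2 : 600 * M ≤ M ^ 5 := by
      have : 600 ≤ M ^ 4 := by
        have : 6 ≤ M := by have := Nat.mul_pos hI.1 hI.2; omega
        calc 600 ≤ 6 ^ 4 := by norm_num
          _ ≤ M ^ 4 := Nat.pow_le_pow_left this 4
      rw [pow_succ]; exact Nat.mul_le_mul_right _ this
    have := hle 5 (by omega)
    omega
  have hv : BinOp.lor.eval (s₄.reg 3) (s₄.reg 3) = outputLength I := by
    simp [BinOp.eval, v₄]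
  refine ⟨s₄.setReg 0 (outputLength I), ?_, m₄, by simp [State.setReg], ?_⟩
  · have e₅ := Exec.op (B := B) (o := .lor) (r := 0) (a := 3) (b := 3) (s := s₄)
      (by rw [hv]; exact hS)
    rw [hv] at e₅
    have := Exec.seq e₁ (.seq e₂ (.seq e₃ (.seq e₄ e₅)))
    rwa [show 1 + (1 + (1 + (outputLengthExpr.steps + 1))) = outputLengthExpr.steps + 4 by ring]
      at this
  · intro i h1 h2
    simp only [State.setReg]
    rw [Function.update_of_ne (by omega)]
    interval_cases i
    · rw [p₄ 1 (by omega), r1]; rfl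
    · rw [p₄ 2 (by omega), r2]; rfl
    · rw [v₄]; rfl

/-- The output goes to the same cells as the input, so the bits are first copied behind the future
output, which is longer than the input. After the output has been written from address `0`, the
pointer is just at the copy, which is erased; then the registers are cleared. The final state is
literally an initial state, so a matching program can be run from it. -/
theorem exists_exec_reductionProg : ∃ K C : ℕ, ∀ I : OVInstance, I.Valid →
    ∃ t, Exec ((I.encode.length + 2) ^ K) reductionProg (initState I.encode) t
      (initState (outputWords I)) ∧ t ≤ C * (I.n * I.d) := by
  obtain ⟨K₁, C₁, H₁⟩ := copyCmd.exists_exec 4 5 (by norm_num)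
  obtain ⟨K₂, C₂, H₂⟩ := outputCmd.exists_exec 4 5 (by norm_num)
  obtain ⟨K₃, C₃, H₃⟩ := eraseCmd.exists_exec 4 5 (by norm_num)
  refine ⟨K₁ + K₂ + K₃ + (outputLengthExpr.deg 5 + 5) + 1,
    outputLengthExpr.steps + C₁ * 5 + C₂ * 2000 + C₃ * 5 + rewriteProg.regBound + 7, ?_⟩
  intro I hI
  have hL := length_encode I
  have hnd : 1 ≤ I.n * I.d := Nat.mul_pos hI.1 hI.2
  obtain ⟨hS1, hS2⟩ := outputLength_le I hI
  generalize hMdef : I.encode.length + 2 = M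
  have hM : M = 4 + 2 * (I.n * I.d) := by omega
  set B := M ^ (K₁ + K₂ + K₃ + (outputLengthExpr.deg 5 + 5) + 1) with hBdef
  have hle : ∀ k ≤ K₁ + K₂ + K₃ + (outputLengthExpr.deg 5 + 5), M ^ k < B := fun k hk =>
    Nat.pow_lt_pow_right (by omega) (by omega)
  have hB : 1 < B := by
    have := hle 1 (by omega)
    rw [pow_one] at this; omega
  -- The output takes at most `600 * (n * d)` cells and the copied bits another `2 * (n * d)`. Since
  -- `6 ≤ M`, the exponent `5` covers all addresses.
  have hM5 : 602 * M ≤ M ^ 5 := by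
    have : 602 ≤ M ^ 4 := by
      calc 602 ≤ 6 ^ 4 := by norm_num
        _ ≤ M ^ 4 := Nat.pow_le_pow_left (by omega) 4
    rw [pow_succ]; exact Nat.mul_le_mul_right _ this
  have hn : I.n ≤ I.n * I.d := Nat.le_mul_of_pos_right _ hI.2
  have hd : I.d ≤ I.n * I.d := Nat.le_mul_of_pos_left _ hI.1
  have hρ : ∀ i, 1 ≤ i → i < 4 → baseEnv I i ≤ M ^ 5 := by
    intro i h1 h2
    interval_cases i
    · rw [baseEnv_one]; omega
    · rw [baseEnv_two]; omega
    · rw [baseEnv_three]; omega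
  obtain ⟨s₁, e₁, m₁, o₁, p₁⟩ := exists_exec_setupProg (B := B) I hI hMdef.symm (hle _ (by omega))
  have hcl := out_copyCmd I
  have hbl := length_inputBits I
  obtain ⟨t₂, s₂, e₂, ht₂, -, m₂, p₂⟩ := H₁ M B s₁ (fun a => a < outputLength I)
    (initState I.encode).mem (baseEnv I) (by omega) (hle _ (by omega))
    (by
      refine ⟨by simp, fun i hi => ?_⟩
      simp only [WordExpr.eval_mul, WordExpr.eval_ofNat, WordExpr.eval_var, baseEnv_one,
        baseEnv_two] at hi
      refine ⟨by simp, ?_⟩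
      simp only [WordExpr.eval_add, WordExpr.eval_ofNat, WordExpr.eval_var, EmitCmd.loopEnv_self]
      omega)
    hρ
    (by
      intro a _
      change I.encode.getD a 0 ≤ _
      rw [encode_eq]
      match a with
      | 0 => simp only [List.getD_cons_zero]; omega
      | 1 => simp only [List.getD_cons_succ, List.getD_cons_zero]; omega
      | a + 2 =>
        have := inputBits_le_one I a
        simp only [List.getD_cons_succ]
        omega)
    p₁ (fun a _ => by rw [m₁])
    (by rw [hcl, o₁, hbl]; omega) (fun a ha => by rw [o₁]; exact .inl ha)
  rw [hcl, o₁, m₁] at m₂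
  have hbits : ∀ a, outputLength I ≤ a → s₂.mem a = bitsAt I a := by
    intro a ha
    rw [m₂, bitsAt, overwrite]
    split
    · rfl
    -- Behind the copy both sides are zero, because the input ends before the output length.
    · rw [List.getD_eq_default _ _ (by omega)]
      exact List.getD_eq_default _ _ (by omega)
  obtain ⟨t₃, s₃, e₃, ht₃, o₃, m₃, p₃⟩ := H₂ M B (s₂.setReg 0 0) (fun a => outputLength I ≤ a)
    (bitsAt I) (baseEnv I) (by omega) (hle _ (by omega)) (ok_outputCmd I) hρ
    (fun a _ => (inputBits_le_one I _).trans (by omega))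
    (fun i h1 h2 => by
      simp only [State.setReg]
      rw [Function.update_of_ne (by omega), p₂ i h1 h2, p₁ i h1 h2])
    hbits
    (by
      rw [out_outputCmd, length_outputWords]
      simp only [State.setReg, Function.update_self]; omega)
    (fun a ha => by
      rw [out_outputCmd, length_outputWords]
      simp only [State.setReg, Function.update_self]; omega)
  simp only [out_outputCmd, length_outputWords, State.setReg, Function.update_self, zero_add]
    at o₃ m₃ p₃
  obtain ⟨t₄, s₄, e₄, ht₄, -, m₄, p₄⟩ := H₃ M B s₃ (fun _ => False) (fun _ => 0) (baseEnv I)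
    (by omega) (hle _ (by omega)) ⟨by simp, fun i _ => by simp [EmitCmd.Ok]⟩ hρ (fun _ h => h.elim)
    (fun i h1 h2 => by
      rw [p₃ i h1 h2, Function.update_of_ne (by omega), p₂ i h1 h2, p₁ i h1 h2])
    (fun _ h => h.elim)
    (by rw [out_eraseCmd, List.length_replicate, o₃]; omega) (fun _ h => h.elim)
  rw [out_eraseCmd, o₃] at m₄
  have er : Exec B rewriteProg (initState I.encode) _ s₄ :=
    .seq e₁ (.seq e₂ (.seq (.lit (by omega)) (.seq e₃ e₄)))
  obtain ⟨s₅, e₅, m₅, z₅, p₅⟩ := exec_clearRegs (B := B) (by omega) (rewriteProg.regBound + 1) s₄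
  have hs₅ : s₅ = initState (outputWords I) := by
    have hreg : s₅.reg = (initState (outputWords I)).reg := by
      ext i
      rcases Nat.lt_or_ge i (rewriteProg.regBound + 1) with h | h
      · rw [z₅ i h]; rfl
      · rw [p₅ i h (by omega), er.reg_eq (by omega)]; rfl
    have hmem : s₅.mem = (initState (outputWords I)).mem := by
      ext i
      have hl := length_outputWords I
      change _ = (outputWords I).getD i 0
      rw [m₅, m₄]
      rcases Nat.lt_or_ge i (outputLength I) with h | h
      · rw [overwrite_of_lt _ h, m₃, overwrite, if_pos (by omega), Nat.sub_zero]
      · rw [List.getD_eq_default _ _ (by omega), overwrite]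
        split
        · simp
        · rename_i h'
          rw [List.length_replicate] at h'
          rw [m₃, overwrite_of_ge (by omega), hbits i h, bitsAt,
            List.getD_eq_default _ _ (by omega)]
    cases s₅
    simp only at hreg hmem
    rw [hreg, hmem]
  refine ⟨_, hs₅ ▸ Exec.seq er e₅, ?_⟩
  have hc₂ : copyCmd.steps (initState I.encode).mem 4 (baseEnv I) ≤ 5 * (I.n * I.d) := by
    simp [copyCmd, EmitCmd.steps]; omega
  have hc₃ := steps_outputCmd I hI
  have hc₄ : eraseCmd.steps (fun _ => 0) 4 (baseEnv I) ≤ 5 * (I.n * I.d) := by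
    simp [eraseCmd, EmitCmd.steps]; omega
  have a₂ := ht₂.trans (Nat.mul_le_mul_left C₁ hc₂)
  have a₃ := ht₃.trans (Nat.mul_le_mul_left C₂ hc₃)
  have a₄ := ht₄.trans (Nat.mul_le_mul_left C₃ hc₄)
  have a₁ : outputLengthExpr.steps + rewriteProg.regBound + 7 ≤
      (outputLengthExpr.steps + rewriteProg.regBound + 7) * (I.n * I.d) :=
    Nat.le_mul_of_pos_right _ hnd
  generalize I.n * I.d = X at *
  have hexp : (outputLengthExpr.steps + C₁ * 5 + C₂ * 2000 + C₃ * 5 + rewriteProg.regBound + 7) * X =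
      (outputLengthExpr.steps + rewriteProg.regBound + 7) * X + C₁ * (5 * X) + C₂ * (2000 * X) +
        C₃ * (5 * X) := by ring
  omega

end OVReduction

namespace OVReduction

open WordRAM

/-! ### Running times -/

theorem mul_le_sq_mul_rpow {n d ε : ℝ} (hn : 1 ≤ n) (hd : 1 ≤ d) (hε : ε ≤ 1) :
    n * d ≤ d ^ 2 * n ^ (2 - ε) := by
  have h1 : n ≤ n ^ (2 - ε) := Real.self_le_rpow_of_one_le hn (by linarith)
  calc n * d ≤ n ^ (2 - ε) * d ^ 2 := by
        gcongr
        nlinarith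
    _ = _ := mul_comm _ _

/-- The exponent is first raised to `1 - δ`, which is possible as `1 ≤ x` and makes the power
monotone in its base as `δ ≤ 1`. The factor `(a * d) ^ (1 - δ)` is at most `a * d`, and the
polynomial dependence on `d` is harmless under the hypothesis. -/
theorem rpow_mul_le {n d a b x z ε δ : ℝ} (hn : 1 ≤ n) (hd : 1 ≤ d) (ha : 1 ≤ a) (hδε : δ ≤ ε)
    (hδ : 0 ≤ δ) (hδ1 : δ ≤ 1) (hx : 1 ≤ x) (hxa : x ≤ a * (n * d)) (hz : 0 ≤ z)
    (hzb : z ≤ b * (n * d)) : x ^ (1 - ε) * z ≤ a * b * (d ^ 2 * n ^ (2 - δ)) := by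
  have had : 1 ≤ a * d := one_le_mul_of_one_le_of_one_le ha hd
  have h1 : x ^ (1 - ε) ≤ a * d * n ^ (1 - δ) :=
    calc x ^ (1 - ε) ≤ x ^ (1 - δ) := Real.rpow_le_rpow_of_exponent_le hx (by linarith)
      _ ≤ (a * d * n) ^ (1 - δ) :=
          Real.rpow_le_rpow (by linarith) (by linarith) (by linarith)
      _ = (a * d) ^ (1 - δ) * n ^ (1 - δ) := Real.mul_rpow (by linarith) (by linarith)
      _ ≤ a * d * n ^ (1 - δ) := by
          gcongr
          calc (a * d) ^ (1 - δ) ≤ (a * d) ^ (1 : ℝ) :=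
                Real.rpow_le_rpow_of_exponent_le had (by linarith)
            _ = a * d := Real.rpow_one _
  calc x ^ (1 - ε) * z ≤ (a * d * n ^ (1 - δ)) * (b * (n * d)) := by gcongr
    _ = a * b * (d ^ 2 * (n ^ (1 - δ) * n ^ (1 : ℝ))) := by rw [Real.rpow_one]; ring
    _ = a * b * (d ^ 2 * n ^ (2 - δ)) := by
        rw [← Real.rpow_add (by linarith)]
        congr 3
        ring

/-- A matching algorithm that is fast on the constructed instances refutes the orthogonal vectors
hypothesis. -/
theorem not_solvableInTime_of_le (hOVH : OrthogonalVectorsHypothesis) {σ : ℕ} (hσ : 4 ≤ σ) {ε : ℝ}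
    (hε : 0 < ε) (hε1 : ε ≤ 1) (T : MatchInstance σ → ℝ) (A : ℝ)
    (hT : ∀ I : OVInstance, I.Valid → 0 ≤ T (matchInstance I hσ) ∧
      T (matchInstance I hσ) ≤ A * ((I.d : ℝ) ^ 2 * (I.n : ℝ) ^ (2 - ε))) :
    ¬ MatchInstance.SolvableInTime σ T := by
  rintro ⟨P, C, k, hP⟩
  obtain ⟨K, C₀, hR⟩ := exists_exec_reductionProg
  -- The output length plus two is at most the fifth power of the input length plus two, so the word
  -- bound with exponent `k` of `P` becomes one with exponent `5 * k`. The absolute value covers a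
  -- negative `C`.
  refine hOVH ε hε ⟨.seq reductionProg P, 2, C₀ + |C| * A, K + 5 * k, fun I hI => ?_⟩
  obtain ⟨t₁, e₁, ht₁⟩ := hR I hI
  obtain ⟨t₂, s, e₂, ht₂, hs⟩ := hP _ (valid_matchInstance I hI hσ)
  rw [encode_matchInstance] at e₂
  have hnd : 1 ≤ I.n * I.d := Nat.mul_pos hI.1 hI.2
  have hlen : (outputWords I).length + 2 ≤ (I.encode.length + 2) ^ 5 := by
    have h1 := (outputLength_le I hI).1
    have h2 : 602 ≤ (I.encode.length + 2) ^ 4 :=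
      calc 602 ≤ 6 ^ 4 := by norm_num
        _ ≤ _ := Nat.pow_le_pow_left (by rw [length_encode]; omega) 4
    have h3 := Nat.mul_le_mul_right (I.encode.length + 2) h2
    rw [← pow_succ, show 4 + 1 = 5 from rfl] at h3
    rw [length_outputWords]
    have h4 := length_encode I
    omega
  have hB₁ : (I.encode.length + 2) ^ K ≤ (I.encode.length + 2) ^ (K + 5 * k) :=
    Nat.pow_le_pow_right (by omega) (by omega)
  have hB₂ : ((outputWords I).length + 2) ^ k ≤ (I.encode.length + 2) ^ (K + 5 * k) :=
    calc _ ≤ ((I.encode.length + 2) ^ 5) ^ k := Nat.pow_le_pow_left hlen k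
      _ = (I.encode.length + 2) ^ (5 * k) := (pow_mul _ _ _).symm
      _ ≤ _ := Nat.pow_le_pow_right (by omega) (by omega)
  refine ⟨_, s, .seq (e₁.mono hB₁) (e₂.mono hB₂), ?_, hs.trans (hasMatch_iff I hI hσ)⟩
  obtain ⟨hT0, hTA⟩ := hT I hI
  have hn1 : (1 : ℝ) ≤ I.n := by exact_mod_cast hI.1
  have hd1 : (1 : ℝ) ≤ I.d := by exact_mod_cast hI.2
  have hmul := mul_le_sq_mul_rpow hn1 hd1 hε1
  have ht₁' : (t₁ : ℝ) ≤ C₀ * ((I.n : ℝ) * I.d) := by exact_mod_cast ht₁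
  push_cast
  calc (t₁ : ℝ) + t₂ ≤ C₀ * ((I.n : ℝ) * I.d) + C * T (matchInstance I hσ) := add_le_add ht₁' ht₂
    _ ≤ C₀ * ((I.d : ℝ) ^ 2 * (I.n : ℝ) ^ (2 - ε)) +
        |C| * (A * ((I.d : ℝ) ^ 2 * (I.n : ℝ) ^ (2 - ε))) := by
        refine add_le_add (by gcongr) ?_
        exact (mul_le_mul_of_nonneg_right (le_abs_self C) hT0).trans (by gcongr)
    _ = _ := by ring

theorem size_matchInstance_le (I : OVInstance) (hI : I.Valid) {σ : ℕ} (hσ : 4 ≤ σ) :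
    ((matchInstance I hσ).size : ℝ) ≤ 600 * ((I.n : ℝ) * I.d) := by
  rw [size_matchInstance]
  exact_mod_cast (outputLength_le I hI).1

theorem numEdges_matchInstance_bounds (I : OVInstance) (hI : I.Valid) {σ : ℕ} (hσ : 4 ≤ σ) :
    (1 : ℝ) ≤ (matchInstance I hσ).numEdges ∧
      ((matchInstance I hσ).numEdges : ℝ) ≤ 216 * ((I.n : ℝ) * I.d) := by
  rw [numEdges_matchInstance]
  have h1 : I.n ≤ I.n * I.d := Nat.le_mul_of_pos_right _ hI.2
  have h2 : 1 ≤ I.n * I.d := Nat.mul_pos hI.1 hI.2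
  have h3 : numBlocks I = 3 * (I.n * I.d) + 3 * I.n := by unfold numBlocks; ring
  constructor
  · exact_mod_cast (show 1 ≤ 36 * (numBlocks I - 1) by omega)
  · exact_mod_cast (show 36 * (numBlocks I - 1) ≤ 216 * (I.n * I.d) by omega)

theorem queryLength_matchInstance_bounds (I : OVInstance) (hI : I.Valid) {σ : ℕ} (hσ : 4 ≤ σ) :
    (1 : ℝ) ≤ (matchInstance I hσ).queryLength ∧
      ((matchInstance I hσ).queryLength : ℝ) ≤ 9 * ((I.n : ℝ) * I.d) := by
  rw [queryLength_matchInstance]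
  have h1 : I.n ≤ I.n * I.d := Nat.le_mul_of_pos_right _ hI.2
  have h2 : 1 ≤ I.n * I.d := Nat.mul_pos hI.1 hI.2
  have h3 : queryLength I = 3 + 3 * I.n + 3 * (I.n * I.d) := by unfold queryLength; ring
  constructor
  · exact_mod_cast (show 1 ≤ queryLength I by omega)
  · exact_mod_cast (show queryLength I ≤ 9 * (I.n * I.d) by omega)

end OVReduction

/-! ### The lower bounds -/

theorem mainTheorem1 (hOVH : OrthogonalVectorsHypothesis) (σ : ℕ) (hσ : 4 ≤ σ)
    (ε : ℝ) (hε : 0 < ε) :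
    (¬ MatchInstance.SolvableInTime σ
        (fun I => (I.size : ℝ) + (I.numEdges : ℝ) ^ (1 - ε) * (I.queryLength : ℝ))) ∧
    (¬ MatchInstance.SolvableInTime σ
        (fun I => (I.size : ℝ) + (I.numEdges : ℝ) * (I.queryLength : ℝ) ^ (1 - ε))) := by
  -- Truncating at `1` keeps `2 - δ ≥ 1`, so that the linear terms for the reduction and for reading
  -- the input stay below the bound.
  have hδ : 0 < min ε 1 := lt_min hε one_pos
  have hδ1 : min ε 1 ≤ 1 := min_le_right _ _
  have hδε : min ε 1 ≤ ε := min_le_left _ _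
  constructor
  all_goals
    -- The constants bound the size by `600`, the edges by `216` and the query by `9` times `n * d`.
    refine OVReduction.not_solvableInTime_of_le hOVH hσ hδ hδ1 _ (600 + 216 * 9)
      fun I hI => ⟨by positivity, ?_⟩
    have hn : (1 : ℝ) ≤ I.n := by exact_mod_cast hI.1
    have hd : (1 : ℝ) ≤ I.d := by exact_mod_cast hI.2
    have hmul := OVReduction.mul_le_sq_mul_rpow hn hd hδ1
    have hs := OVReduction.size_matchInstance_le I hI hσ
    obtain ⟨hE1, hE⟩ := OVReduction.numEdges_matchInstance_bounds I hI hσ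
    obtain ⟨hQ1, hQ⟩ := OVReduction.queryLength_matchInstance_bounds I hI hσ
  · have := OVReduction.rpow_mul_le hn hd (by norm_num) hδε hδ.le hδ1 hE1 hE (by linarith) hQ
    linarith
  · have := OVReduction.rpow_mul_le hn hd (by norm_num) hδε hδ.le hδ1 hQ1 hQ (by linarith) hE
    linarith
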